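/- Let $(X,\mathcal B,\mu)$ be a standard (non-atomic) probability space and let $Aut$ be the group of its automorphisms, i.e. of the invertible $\mu$-preserving transformations of $X$, considered up to equality $\mu$-almost everywhere. Let $(A_i)_{i\ge 0}$ be a sequence of measurable sets that is dense in $\mathcal B$ (with respect to the distance $\mu(B\,\Delta\,C)$), and equip $Aut$ with the Halmos metric $$\rho(S,T)=\sum_{i} 2^{-i}\bigl(\mu(SA_i\,\Delta\, TA_i)+\mu(S^{-1}A_i\,\Delta\, T^{-1}A_i)\bigr).$$ Let $L(j)$ be a sequence of natural numbers with $L(j)\to\infty$, and let $P_j=\{j,2j,\dots,L(j)j\}$. For $S\in Aut$ define $$h_P(S)=\sup_\xi\ \limsup_{j\to\infty}\ \frac1{|P_j|}\,H\Bigl(\bigvee_{p\in P_j}S^p\xi\Bigr),$$ where the supremum is over all finite measurable partitions $\xi$ of $X$, $S^p\xi$ is the partition into the images under $S^p$ of the cells of $\xi$, and $H(\{C_1,\dots,C_n\})=-\sum_{i=1}^n\mu(C_i)\ln\mu(C_i)$ (with $0\ln 0=0$). Then the set $\{S\in Aut : h_P(S)=\infty\}$ is generic, i.e. it contains a $G_\delta$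 set that is dense in $(Aut,\rho)$. -/

import Mathlib

open MeasureTheory Filter Topology Set
open scoped symmDiff

noncomputable section

namespace KushnirenkoEntropy

variable {X : Type*} [MeasurableSpace X]

/-! ### The group of automorphisms of a measure space -/

/-- Invertible transformations of `X` that preserve `μ` together with their inverses
(measurability of both maps is part of `MeasurePreserving`). -/
def mpGroup (μ : Measure X) : Subgroup (Equiv.Perm X) where
  carrier := {S | MeasurePreserving S μ μ ∧ MeasurePreserving S.symm μ μ}
  mul_mem' := fun {_ _} hS hT => ⟨hS.1.comp hT.1, hT.2.comp hS.2⟩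
  one_mem' := ⟨MeasurePreserving.id μ, MeasurePreserving.id μ⟩
  inv_mem' := fun {_} hS => ⟨hS.2, hS.1⟩

theorem mpGroup.measurePreserving {μ : Measure X} (S : mpGroup μ) :
    MeasurePreserving (S : Equiv.Perm X) μ μ := S.2.1

/-- The transformations that are equal to the identity almost everywhere. -/
def nullGroup (μ : Measure X) : Subgroup (mpGroup μ) where
  carrier := {S | ∀ᵐ x ∂μ, (S : Equiv.Perm X) x = x}
  mul_mem' := by
    intro S T hS hT
    simp only [Set.mem_ofPred_eq] at hS hT ⊢
    filter_upwards [hS, hT] with x hxS hxT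
    simp [Equiv.Perm.mul_apply, hxT, hxS]
  one_mem' := by simp
  inv_mem' := by
    intro S hS
    simp only [Set.mem_ofPred_eq] at hS ⊢
    filter_upwards [hS] with x hx
    rw [Subgroup.coe_inv, Equiv.Perm.inv_eq_iff_eq, hx]

instance nullGroup_normal (μ : Measure X) : (nullGroup μ).Normal where
  conj_mem := by
    intro N hN T
    have hN' : ∀ᵐ x ∂μ, (N : Equiv.Perm X) x = x := hN
    have h := (mpGroup.measurePreserving T⁻¹).quasiMeasurePreserving.ae hN'
    change ∀ᵐ x ∂μ, ((T * N * T⁻¹ : mpGroup μ) : Equiv.Perm X) x = x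
    filter_upwards [h] with x hx
    simp only [Subgroup.coe_mul, Equiv.Perm.mul_apply, hx]
    simp

/-- The group `Aut` of automorphisms of `(X, μ)`: invertible measure-preserving transformations,
two of them being identified when they are equal almost everywhere. -/
abbrev Aut (μ : Measure X) : Type _ := mpGroup μ ⧸ nullGroup μ

/-- Representatives of the same automorphism move every set to the same set modulo `μ`. -/
theorem image_ae_eq {μ : Measure X} {S T : mpGroup μ} (h : (S : Aut μ) = (T : Aut μ))
    (C : Set X) : ((S : Equiv.Perm X) '' C : Set X) =ᵐ[μ] ((T : Equiv.Perm X) '' C : Set X) := by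
  have h1 : ((S⁻¹ : mpGroup μ) : Aut μ) = ((T⁻¹ : mpGroup μ) : Aut μ) := by
    rw [QuotientGroup.mk_inv, QuotientGroup.mk_inv, h]
  have h2 : ∀ᵐ x ∂μ, (((S⁻¹)⁻¹ * T⁻¹ : mpGroup μ) : Equiv.Perm X) x = x := QuotientGroup.eq.1 h1
  rw [eventuallyEq_set]
  filter_upwards [h2] with x hx
  have hx' : (S : Equiv.Perm X) ((T : Equiv.Perm X).symm x) = x := by
    simpa [Equiv.Perm.mul_apply] using hx
  rw [Equiv.image_eq_preimage_symm, Equiv.image_eq_preimage_symm, Set.mem_preimage,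
    Set.mem_preimage, (Equiv.symm_apply_eq _).2 hx'.symm]

/-! ### The Halmos metric -/

/-- The number `μ(S A ∆ T A)`. -/
def imageDist (μ : Measure X) (A : Set X) (S T : Aut μ) : ℝ :=
  Quotient.liftOn₂ S T
    (fun S T => μ.real (((S : Equiv.Perm X) '' A) ∆ ((T : Equiv.Perm X) '' A)))
    (fun _ _ _ _ h₁ h₂ => measureReal_congr
      (ae_eq_set_symmDiff (image_ae_eq (Quotient.sound h₁) A) (image_ae_eq (Quotient.sound h₂) A)))

/-- The Halmos distance
`ρ(S, T) = ∑ i, 2⁻ⁱ (μ(S Aᵢ ∆ T Aᵢ) + μ(S⁻¹ Aᵢ ∆ T⁻¹ Aᵢ))` built on a sequence of sets. -/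
def halmosDist (μ : Measure X) (A : ℕ → Set X) (S T : Aut μ) : ℝ :=
  ∑' i, (1 / 2 : ℝ) ^ i * (imageDist μ (A i) S T + imageDist μ (A i) S⁻¹ T⁻¹)

/-- The sequence `A` of measurable sets is dense in the σ-algebra of measurable sets, with respect
to the distance `μ(B ∆ C)`. -/
structure IsDenseSeq (μ : Measure X) (A : ℕ → Set X) : Prop where
  measurableSet (i : ℕ) : MeasurableSet (A i)
  exists_lt (B : Set X) (hB : MeasurableSet B) (ε : ℝ) (hε : 0 < ε) : ∃ i, μ.real (A i ∆ B) < ε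

theorem imageDist_nonneg (μ : Measure X) (A : Set X) (S T : Aut μ) : 0 ≤ imageDist μ A S T := by
  induction S, T using Quotient.inductionOn₂
  exact measureReal_nonneg

theorem imageDist_self (μ : Measure X) (A : Set X) (S : Aut μ) : imageDist μ A S S = 0 := by
  induction S using Quotient.inductionOn
  simp [imageDist]

theorem imageDist_comm (μ : Measure X) (A : Set X) (S T : Aut μ) :
    imageDist μ A S T = imageDist μ A T S := by
  induction S, T using Quotient.inductionOn₂
  simp [imageDist, symmDiff_comm]

theorem imageDist_triangle (μ : Measure X) [IsFiniteMeasure μ] (A : Set X) (S T U : Aut μ) :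
    imageDist μ A S U ≤ imageDist μ A S T + imageDist μ A T U := by
  induction S, T using Quotient.inductionOn₂
  induction U using Quotient.inductionOn
  exact measureReal_symmDiff_le _

theorem imageDist_le (μ : Measure X) [IsFiniteMeasure μ] (A : Set X) (S T : Aut μ) :
    imageDist μ A S T ≤ μ.real univ := by
  induction S, T using Quotient.inductionOn₂
  exact measureReal_mono (subset_univ _)

theorem summable_halmos (μ : Measure X) [IsFiniteMeasure μ] (A : ℕ → Set X) (S T : Aut μ) :
    Summable fun i =>
      (1 / 2 : ℝ) ^ i * (imageDist μ (A i) S T + imageDist μ (A i) S⁻¹ T⁻¹) := by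
  refine Summable.of_nonneg_of_le (fun i => ?_) (fun i => ?_)
    (summable_geometric_two.mul_right (μ.real univ + μ.real univ))
  · have := imageDist_nonneg μ (A i) S T
    have := imageDist_nonneg μ (A i) S⁻¹ T⁻¹
    positivity
  · exact mul_le_mul_of_nonneg_left
      (add_le_add (imageDist_le _ _ _ _) (imageDist_le _ _ _ _)) (by positivity)

theorem measureReal_image (μ : Measure X) (S : mpGroup μ) {B : Set X} (hB : MeasurableSet B) :
    μ.real ((S : Equiv.Perm X) '' B) = μ.real B := by
  rw [Equiv.image_eq_preimage_symm, Measure.real, Measure.real,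
    S.2.2.measure_preimage hB.nullMeasurableSet]

theorem eq_of_imageDist_eq_zero (μ : Measure X) [IsFiniteMeasure μ] [StandardBorelSpace X]
    {A : ℕ → Set X} (hA : IsDenseSeq μ A) {S T : Aut μ}
    (h : ∀ i, imageDist μ (A i) S T = 0) : S = T := by
  have hall : ∀ B, MeasurableSet B → imageDist μ B S T = 0 := by
    intro B hB
    refine le_antisymm (le_of_forall_pos_le_add fun ε hε => ?_) (imageDist_nonneg _ _ _ _)
    obtain ⟨i, hi⟩ := hA.exists_lt B hB (ε / 2) (by positivity)
    have hi0 := h i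
    induction S, T using Quotient.inductionOn₂ with | _ S T
    change μ.real (((S : Equiv.Perm X) '' (A i)) ∆ ((T : Equiv.Perm X) '' (A i))) = 0 at hi0
    change μ.real (((S : Equiv.Perm X) '' B) ∆ ((T : Equiv.Perm X) '' B)) ≤ 0 + ε
    have hm : MeasurableSet (A i ∆ B) := (hA.measurableSet i).symmDiff hB
    have e1 : μ.real (((S : Equiv.Perm X) '' B) ∆ ((S : Equiv.Perm X) '' A i)) < ε / 2 := by
      rw [← Set.image_symmDiff (S : Equiv.Perm X).injective, symmDiff_comm,
        measureReal_image μ S hm]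
      exact hi
    have e2 : μ.real (((T : Equiv.Perm X) '' A i) ∆ ((T : Equiv.Perm X) '' B)) < ε / 2 := by
      rw [← Set.image_symmDiff (T : Equiv.Perm X).injective, measureReal_image μ T hm]
      exact hi
    have t1 := measureReal_symmDiff_le (μ := μ) (s := (S : Equiv.Perm X) '' B)
      (t := (S : Equiv.Perm X) '' A i) ((T : Equiv.Perm X) '' B)
    have t2 := measureReal_symmDiff_le (μ := μ) (s := (S : Equiv.Perm X) '' A i)
      (t := (T : Equiv.Perm X) '' A i) ((T : Equiv.Perm X) '' B)
    linarith
  rw [← inv_inj]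
  induction S, T using Quotient.inductionOn₂ with | _ S T
  have key : ((S : Equiv.Perm X).symm : X → X) =ᵐ[μ] (T : Equiv.Perm X).symm := by
    refine Filter.EventuallyEq.of_forall_separating_preimage (p := MeasurableSet) ?_
    intro B hB
    have := hall B hB
    change μ.real (((S : Equiv.Perm X) '' B) ∆ ((T : Equiv.Perm X) '' B)) = 0 at this
    rw [measureReal_eq_zero_iff, measure_symmDiff_eq_zero_iff, Equiv.image_eq_preimage_symm,
      Equiv.image_eq_preimage_symm] at this
    exact this
  change ((S⁻¹ : mpGroup μ) : Aut μ) = ((T⁻¹ : mpGroup μ) : Aut μ)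
  refine QuotientGroup.eq.2 ?_
  change ∀ᵐ x ∂μ, (((S⁻¹)⁻¹ * T⁻¹ : mpGroup μ) : Equiv.Perm X) x = x
  filter_upwards [key] with x hx
  have : (S : Equiv.Perm X) ((T : Equiv.Perm X).symm x) = x := by rw [← hx]; simp
  simpa [Equiv.Perm.mul_apply] using this

/-- The Halmos metric on `Aut` that is built on a dense sequence of measurable sets. -/
@[reducible]
def halmosMetric (μ : Measure X) [IsFiniteMeasure μ] [StandardBorelSpace X] (A : ℕ → Set X)
    (hA : IsDenseSeq μ A) : MetricSpace (Aut μ) where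
  dist := halmosDist μ A
  dist_self S := by simp [halmosDist, imageDist_self]
  dist_comm S T := by
    simp only [halmosDist]
    refine tsum_congr fun i => ?_
    rw [imageDist_comm, imageDist_comm μ (A i) S⁻¹]
  dist_triangle S T U := by
    simp only [halmosDist]
    rw [← (summable_halmos μ A S T).tsum_add (summable_halmos μ A T U)]
    refine (summable_halmos μ A S U).tsum_le_tsum (fun i => ?_)
      ((summable_halmos μ A S T).add (summable_halmos μ A T U))
    rw [← mul_add]
    refine mul_le_mul_of_nonneg_left ?_ (by positivity)
    have := imageDist_triangle μ (A i) S T U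
    have := imageDist_triangle μ (A i) S⁻¹ T⁻¹ U⁻¹
    linarith
  eq_of_dist_eq_zero := by
    intro S T h
    refine eq_of_imageDist_eq_zero μ hA fun i => ?_
    have hn : ∀ i, 0 ≤ imageDist μ (A i) S T + imageDist μ (A i) S⁻¹ T⁻¹ := fun i =>
      add_nonneg (imageDist_nonneg _ _ _ _) (imageDist_nonneg _ _ _ _)
    have hle := (summable_halmos μ A S T).le_tsum i
      (fun j _ => mul_nonneg (by positivity) (hn j))
    have h0 : ∑' i, (1 / 2 : ℝ) ^ i * (imageDist μ (A i) S T + imageDist μ (A i) S⁻¹ T⁻¹) = 0 := h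
    rw [h0] at hle
    have hpos : (0 : ℝ) < (1 / 2 : ℝ) ^ i := by positivity
    have h1 : imageDist μ (A i) S T + imageDist μ (A i) S⁻¹ T⁻¹ ≤ 0 := by
      by_contra hc
      push Not at hc
      exact absurd hle (not_le.2 (mul_pos hpos hc))
    have h2 := imageDist_nonneg μ (A i) S T
    have h3 := imageDist_nonneg μ (A i) S⁻¹ T⁻¹
    linarith

/-- A set is generic if it contains a dense `G_δ` set. -/
def IsGeneric {Y : Type*} [TopologicalSpace Y] (s : Set Y) : Prop :=
  ∃ W ⊆ s, IsGδ W ∧ Dense W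

/-! ### Partitions and entropy -/

/-- A measurable partition of `X` with cells indexed by `ι` (empty cells are allowed). -/
structure MeasPartition (X : Type*) [MeasurableSpace X] (ι : Type*) where
  cell : ι → Set X
  measurableSet_cell (i : ι) : MeasurableSet (cell i)
  disjoint : Pairwise fun i j => Disjoint (cell i) (cell j)
  iUnion_cell : ⋃ i, cell i = univ

/-- The partition `S ξ`, with cells `S C` for the cells `C` of `ξ`. -/
def MeasPartition.image {ι : Type*} {μ : Measure X} (S : mpGroup μ) (ξ : MeasPartition X ι) :
    MeasPartition X ι where
  cell i := (S : Equiv.Perm X) '' ξ.cell i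
  measurableSet_cell i := by
    rw [Equiv.image_eq_preimage_symm]
    exact S.2.2.measurable (ξ.measurableSet_cell i)
  disjoint i j hij := (Set.disjoint_image_iff (S : Equiv.Perm X).injective).2 (ξ.disjoint hij)
  iUnion_cell := by
    rw [← Set.image_iUnion, ξ.iUnion_cell, Set.image_univ, (S : Equiv.Perm X).range_eq_univ]

/-- The join `⋁ k, η k` of a finite family of partitions: its cells are the intersections of one
cell from each of them. -/
def MeasPartition.join {ι κ : Type*} [Finite κ] (η : κ → MeasPartition X ι) :
    MeasPartition X (κ → ι) where
  cell a := ⋂ k, (η k).cell (a k)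
  measurableSet_cell a := MeasurableSet.iInter fun k => (η k).measurableSet_cell (a k)
  disjoint a b hab := by
    obtain ⟨k, hk⟩ := Function.ne_iff.1 hab
    exact ((η k).disjoint hk).mono (Set.iInter_subset _ k) (Set.iInter_subset _ k)
  iUnion_cell := by
    refine Set.eq_univ_of_forall fun x => ?_
    have h : ∀ k, ∃ i, x ∈ (η k).cell i := fun k => by
      rw [← Set.mem_iUnion, (η k).iUnion_cell]; trivial
    choose a ha using h
    exact Set.mem_iUnion.2 ⟨a, Set.mem_iInter.2 ha⟩

/-- The entropy `H(ξ) = -∑ i, μ(Cᵢ) ln μ(Cᵢ)` of a finite partition, with `0 ln 0 = 0`. -/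
def MeasPartition.entropy {ι : Type*} [Fintype ι] (μ : Measure X) (ξ : MeasPartition X ι) : ℝ :=
  -∑ i, μ.real (ξ.cell i) * Real.log (μ.real (ξ.cell i))

/-- `h(S, ξ) = |F|⁻¹ H(⋁_{p ∈ F} S^p ξ)` for a finite set `F` of integers. -/
def meanEntropy (μ : Measure X) (F : Finset ℤ) {n : ℕ} (ξ : MeasPartition X (Fin n))
    (S : Aut μ) : ℝ :=
  Quotient.liftOn S
    (fun S => (1 / (F.card : ℝ)) *
      (MeasPartition.join fun p : F => ξ.image (S ^ (p : ℤ))).entropy μ)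
    (by
      intro S T h
      have hST : (S : Aut μ) = (T : Aut μ) := Quotient.sound h
      have hpow (p : ℤ) : ((S ^ p : mpGroup μ) : Aut μ) = ((T ^ p : mpGroup μ) : Aut μ) := by
        rw [QuotientGroup.mk_zpow, QuotientGroup.mk_zpow, hST]
      have hcell (a : F → Fin n) :
          μ.real ((MeasPartition.join fun p : F => ξ.image (S ^ (p : ℤ))).cell a) =
            μ.real ((MeasPartition.join fun p : F => ξ.image (T ^ (p : ℤ))).cell a) :=
        measureReal_congr (Filter.EventuallyEq.countable_iInter fun p => image_ae_eq (hpow p) _)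
      simp only [MeasPartition.entropy, hcell])

/-- The entropy `h_P(S) = sup_ξ limsup_j |P_j|⁻¹ H(⋁_{p ∈ P_j} S^p ξ)` along a sequence `P` of
finite sets of integers; the supremum is over all finite measurable partitions. -/
def pEntropy (μ : Measure X) (P : ℕ → Finset ℤ) (S : Aut μ) : EReal :=
  ⨆ (n : ℕ) (ξ : MeasPartition X (Fin n)),
    limsup (fun j => (meanEntropy μ (P j) ξ S : EReal)) atTop

/-- The progressions `P_j = {j, 2j, …, L(j) j}`. -/
def progression (L : ℕ → ℕ) (j : ℕ) : Finset ℤ :=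
  (Finset.Icc 1 (L j)).image fun k : ℕ => (k : ℤ) * (j : ℤ)

end KushnirenkoEntropy

end

/-!
The Halmos metric is complete, so by Baire's theorem it suffices that for every `c` there is a
partition `ξ` such that the open set of those `S` with `h(S, ξ) > c` along some `P_j`, `j ≥ N`, is
dense for every `N`.

Take any `ξ` with `H(ξ) > c`, and let `S` be an automorphism. Consider the stationary process that
runs through segments `z, S z, …, S ^ (M - 1) z` of orbits of `S`, with independent starting points
`z` of law `μ` and a uniformly distributed phase. It jumps from one segment to the next with
probability `1 / M` per unit of time, and its values at the times `k M` are independent of law `μ`.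
As all standard non-atomic probability spaces are isomorphic, the shift on this process can be
copied to `X`, in a way that respects any prescribed finite family of events. The resulting
automorphism `T` is close to `S`, while the partitions `T ^ p ξ` with `M ∣ p` are independent and
their mean entropy is `H(ξ)`.

Completeness is point realization: a Cauchy sequence of automorphisms converges on each set of the
measure algebra, the limits of the preimages of binary coordinates define a limit map, and the limit
of the inverses is an inverse of it almost everywhere.
-/

noncomputable section

namespace KushnirenkoEntropy

/-! ### Isomorphism of labelled probability spaces -/

section Isomorphism

open ProbabilityTheory

variable {X Y : Type*} [MeasurableSpace X] [MeasurableSpace Y]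

theorem uncountable_of_nullSingletonClass (μ : Measure X) [NeZero μ] [NullSingletonClass μ] :
    Uncountable X := by
  by_contra h
  rw [not_uncountable_iff] at h
  exact NeZero.ne μ (Measure.measure_univ_eq_zero.1 (countable_univ.measure_zero μ))

theorem exists_measurableSet_not_countable_measure_eq_zero [StandardBorelSpace X] [Uncountable X]
    (μ : Measure X) [SFinite μ] : ∃ K, MeasurableSet K ∧ ¬ K.Countable ∧ μ K = 0 := by
  have hℝ : ¬ Countable (ℝ × ℝ) := fun _ =>
    not_countable (α := ℝ) (Prod.mk_right_injective (0 : ℝ)).countable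
  let e : X ≃ᵐ ℝ × ℝ := PolishSpace.measurableEquivOfNotCountable (not_countable (α := X)) hℝ
  have hfst : Measurable fun x => (e x).1 := measurable_fst.comp e.measurable
  obtain ⟨t, ht⟩ : ∃ t, ¬ 0 < μ {x | (e x).1 = t} := by
    by_contra! h
    exact not_countable_univ ((Measure.countable_meas_level_set_pos hfst).mono fun t _ => h t)
  refine ⟨_, hfst (measurableSet_singleton t), fun hK => ?_, nonpos_iff_eq_zero.1 (not_lt.1 ht)⟩
  have hmaps : MapsTo (fun r => e.symm (t, r)) univ ((fun x => (e x).1) ⁻¹' {t}) := by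
    simp [MapsTo]
  have hinj : Function.Injective fun r => e.symm (t, r) :=
    e.symm.injective.comp (Prod.mk_right_injective t)
  exact not_countable_univ (hmaps.countable_of_injOn hinj.injOn hK)

theorem exists_measurableEquiv_eqOn [StandardBorelSpace X] [StandardBorelSpace Y] {f : X → Y}
    (hf : Measurable f) {W : Set X} (hW : MeasurableSet W) (hinj : InjOn f W)
    (hWc : ¬ Wᶜ.Countable) (hrange : ¬ (f '' W)ᶜ.Countable) : ∃ e : X ≃ᵐ Y, EqOn e f W := by
  classical
  have := hW.standardBorel
  have := hW.compl.standardBorel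
  have hfW : MeasurableEmbedding (W.domRestrict f) :=
    (hf.comp measurable_subtype_coe).measurableEmbedding hinj.injective
  have := hfW.measurableSet_range.compl.standardBorel
  rw [← range_domRestrict, ← countable_coe_iff] at hrange
  rw [← countable_coe_iff] at hWc
  refine ⟨(MeasurableEquiv.sumCompl hW).symm.trans
    ((hfW.equivRange.sumCongr (PolishSpace.measurableEquivOfNotCountable hWc hrange)).trans
      (MeasurableEquiv.sumCompl hfW.measurableSet_range)), fun x hx => ?_⟩
  lift x to W using hx
  have hinl : (MeasurableEquiv.sumCompl hW).symm x = Sum.inl x :=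
    Equiv.sumCompl_symm_apply_of_pos x.2
  change MeasurableEquiv.sumCompl hfW.measurableSet_range (hfW.equivRange.sumCongr _
    ((MeasurableEquiv.sumCompl hW).symm x)) = f x
  rw [hinl]
  exact congrArg Subtype.val (hfW.equivRange_apply x)

theorem exists_measurableEquiv_ae_eq_of_injOn [StandardBorelSpace X] [StandardBorelSpace Y]
    {μ : Measure X} {ν : Measure Y} [SFinite μ] [SFinite ν] [NeZero μ]
    [NullSingletonClass μ] [NullSingletonClass ν] {f : X → Y} (hf : MeasurePreserving f μ ν)
    {Z : Set X} (hZ : MeasurableSet Z) (hZ0 : μ Zᶜ = 0) (hinj : InjOn f Z) :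
    ∃ e : X ≃ᵐ Y, e =ᵐ[μ] f := by
  have : NeZero ν := ⟨by
    rw [← hf.map_eq, Measure.map_ne_zero_iff hf.aemeasurable]
    exact NeZero.ne μ⟩
  have := uncountable_of_nullSingletonClass μ
  have := uncountable_of_nullSingletonClass ν
  -- Uncountable null sets are removed on both sides, so that both complements are uncountable.
  obtain ⟨K, hKm, hKc, hK0⟩ := exists_measurableSet_not_countable_measure_eq_zero μ
  obtain ⟨K', hKm', hKc', hK0'⟩ := exists_measurableSet_not_countable_measure_eq_zero ν
  have hnull : μ (Z \ (K ∪ f ⁻¹' K'))ᶜ = 0 := by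
    rw [compl_sdiff, union_comm, measure_union_null_iff, measure_union_null_iff,
      hf.measure_preimage hKm'.nullMeasurableSet]
    exact ⟨hZ0, hK0, hK0'⟩
  have hKW : K ⊆ (Z \ (K ∪ f ⁻¹' K'))ᶜ := fun x hx hxW => hxW.2 (.inl hx)
  have hKW' : K' ⊆ (f '' (Z \ (K ∪ f ⁻¹' K')))ᶜ := by
    rintro _ hy ⟨x, hx, rfl⟩
    exact hx.2 (.inr hy)
  obtain ⟨e, he⟩ := exists_measurableEquiv_eqOn hf.measurable
    (hZ.diff (hKm.union (hf.measurable hKm'))) (hinj.mono sdiff_subset)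
    (fun h => hKc (h.mono hKW)) (fun h => hKc' (h.mono hKW'))
  refine ⟨e, ?_⟩
  filter_upwards [measure_eq_zero_iff_ae_notMem.1 hnull] with x hx using he (not_not.1 hx)

theorem continuous_cdf (μ : Measure ℝ) [IsProbabilityMeasure μ] [NullSingletonClass μ] :
    Continuous (cdf μ) := by
  refine continuous_iff_continuousAt.2 fun x => ?_
  rw [(monotone_cdf μ).continuousAt_iff_leftLim_eq_rightLim,
    StieltjesFunction.rightLim_eq]
  have hjump := (cdf μ).measure_singleton x
  rw [measure_cdf, measure_singleton, eq_comm, ENNReal.ofReal_eq_zero] at hjump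
  exact le_antisymm ((monotone_cdf μ).leftLim_le le_rfl) (by linarith)

theorem measureReal_cdf_preimage_Iic (μ : Measure ℝ) [IsProbabilityMeasure μ]
    [NullSingletonClass μ] {t : ℝ} (ht : t ∈ Ico (0 : ℝ) 1) :
    μ.real (cdf μ ⁻¹' Iic t) = t := by
  have hmono := monotone_cdf μ
  have hsurj : ∀ r ∈ Ioo (0 : ℝ) 1, ∃ s, μ.real (Iic s) = r ∧ cdf μ s = r := by
    intro r hr
    obtain ⟨s, hs⟩ := mem_range_of_exists_le_of_exists_ge (continuous_cdf μ)
      ((tendsto_cdf_atBot μ).eventually_le_const hr.1).exists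
      ((tendsto_cdf_atTop μ).eventually_const_le hr.2).exists
    exact ⟨s, by rw [← cdf_eq_real, hs], hs⟩
  refine le_antisymm (le_of_forall_gt_imp_ge_of_dense fun r hr => ?_) ?_
  · rcases le_or_gt 1 r with h1 | h1
    · exact measureReal_le_one.trans h1
    obtain ⟨s, hs, hFs⟩ := hsurj r ⟨ht.1.trans_lt hr, h1⟩
    rw [← hs]
    refine measureReal_mono fun x hx => le_of_lt (hmono.reflect_lt ?_)
    exact lt_of_le_of_lt hx (hr.trans_eq hFs.symm)
  · rcases ht.1.eq_or_lt with h0 | h0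
    · exact h0 ▸ measureReal_nonneg
    obtain ⟨s, hs, hFs⟩ := hsurj t ⟨h0, ht.2⟩
    conv_lhs => rw [← hs]
    exact measureReal_mono fun x hx => (hmono hx).trans_eq hFs

theorem measurePreserving_cdf (μ : Measure ℝ) [IsProbabilityMeasure μ] [NullSingletonClass μ] :
    MeasurePreserving (cdf μ) μ (volume.restrict (Icc (0 : ℝ) 1)) := by
  have hmeas : Measurable (cdf μ) := (continuous_cdf μ).measurable
  have : IsProbabilityMeasure (μ.map (cdf μ)) :=
    Measure.isProbabilityMeasure_map hmeas.aemeasurable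
  refine ⟨hmeas, Measure.ext_of_Iic _ _ fun t => ?_⟩
  rw [Measure.map_apply hmeas measurableSet_Iic, Measure.restrict_apply measurableSet_Iic]
  rcases lt_or_ge t 0 with h0 | h0
  · have hpre : cdf μ ⁻¹' Iic t = ∅ := eq_empty_of_forall_notMem fun x hx =>
      absurd (hx.trans_lt h0) (not_lt.2 (cdf_nonneg μ x))
    have hinter : Iic t ∩ Icc (0 : ℝ) 1 = ∅ := eq_empty_of_forall_notMem fun x hx =>
      absurd (hx.1.trans_lt h0) (not_lt.2 hx.2.1)
    rw [hpre, hinter, measure_empty, measure_empty]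
  rcases le_or_gt 1 t with h1 | h1
  · have hpre : cdf μ ⁻¹' Iic t = univ :=
      eq_univ_of_forall fun x => (cdf_le_one μ x).trans h1
    have hinter : Iic t ∩ Icc (0 : ℝ) 1 = Icc 0 1 := inter_eq_right.2 fun x hx => hx.2.trans h1
    simp [hpre, hinter]
  · have hinter : Iic t ∩ Icc (0 : ℝ) 1 = Icc 0 t := by
      rw [← Ici_inter_Iic, inter_left_comm, Iic_inter_Iic, inf_eq_left.2 h1.le, Ici_inter_Iic]
    rw [hinter, Real.volume_Icc, sub_zero, ← measureReal_cdf_preimage_Iic μ ⟨h0, h1⟩,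
      ofReal_measureReal, measureReal_cdf_preimage_Iic μ ⟨h0, h1⟩]

theorem exists_injOn_of_monotone {μ ν : Measure ℝ} [NullSingletonClass ν] {F : ℝ → ℝ}
    (hF : MeasurePreserving F μ ν) (hmono : Monotone F) :
    ∃ Z, MeasurableSet Z ∧ μ Zᶜ = 0 ∧ InjOn F Z := by
  let D : Set ℝ := ⋃ q : ℚ, F ⁻¹' {F q} ∩ Ioi (q : ℝ)
  have hD : MeasurableSet D := .iUnion fun q =>
    (hF.measurable (measurableSet_singleton _)).inter measurableSet_Ioi
  have hD0 : μ D = 0 := measure_iUnion_null fun q => measure_mono_null inter_subset_left <| by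
    rw [hF.measure_preimage (measurableSet_singleton _).nullMeasurableSet, measure_singleton]
  have hlt : ∀ x y, x < y → y ∉ D → F x ≠ F y := by
    intro x y hxy hy h
    obtain ⟨q, hxq, hqy⟩ := exists_rat_btwn hxy
    exact hy (mem_iUnion.2 ⟨q, le_antisymm (h ▸ hmono hxq.le) (hmono hqy.le), hqy⟩)
  refine ⟨Dᶜ, hD.compl, by rwa [compl_compl], fun x hx y hy h => ?_⟩
  by_contra hne
  rcases lt_or_gt_of_ne hne with hxy | hxy
  · exact hlt x y hxy hy h
  · exact hlt y x hxy hx h.symm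

theorem exists_measurableEquiv_ae_eq_cdf [StandardBorelSpace X] (μ : Measure X)
    [IsProbabilityMeasure μ] [NullSingletonClass μ] {V : X → ℝ} (hV : MeasurableEmbedding V) :
    ∃ e : X ≃ᵐ ℝ, e =ᵐ[μ] cdf (μ.map V) ∘ V ∧
      MeasurePreserving e μ (volume.restrict (Icc (0 : ℝ) 1)) := by
  have := Measure.isProbabilityMeasure_map (μ := μ) hV.measurable.aemeasurable
  have : NullSingletonClass (μ.map V) := ⟨fun y => by
    rw [hV.map_apply]
    exact (subsingleton_singleton.preimage hV.injective).measure_zero μ⟩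
  have hcdf := measurePreserving_cdf (μ.map V)
  obtain ⟨Z, hZ, hZ0, hinj⟩ :=
    exists_injOn_of_monotone hcdf (monotone_cdf (μ.map V))
  have hcomp := hcdf.comp (hV.measurable.measurePreserving μ)
  obtain ⟨e, he⟩ := exists_measurableEquiv_ae_eq_of_injOn hcomp (hV.measurable hZ)
    (by rwa [← preimage_compl, ← hV.map_apply])
    (fun x hx y hy h => hV.injective (hinj hx hy h))
  exact ⟨e, he, e.measurable, (Measure.map_congr he).trans hcomp.map_eq⟩

/-- An injective coding of `X` by real numbers whose integer part is the label `f x`. -/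
def labelCode [StandardBorelSpace X] (f : X → ℕ) (x : X) : ℝ :=
  f x + Real.sigmoid (embeddingReal X x)

theorem labelCode_le_iff [StandardBorelSpace X] (f : X → ℕ) (x : X) (k : ℕ) :
    labelCode f x ≤ k ↔ f x < k := by
  have h0 := Real.sigmoid_pos (embeddingReal X x)
  have h1 := Real.sigmoid_lt_one (embeddingReal X x)
  unfold labelCode
  constructor
  · intro h
    exact_mod_cast (show (f x : ℝ) < k by linarith)
  · intro h
    have : (f x : ℝ) + 1 ≤ k := by exact_mod_cast h
    linarith

theorem measurableEmbedding_labelCode [StandardBorelSpace X] {f : X → ℕ} (hf : Measurable f) :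
    MeasurableEmbedding (labelCode f) := by
  have hmeas : Measurable (labelCode f) := (measurable_from_nat.comp hf).add
    (continuous_sigmoid.measurable.comp (measurable_embeddingReal X))
  refine hmeas.measurableEmbedding fun x y hxy => ?_
  have hle : ∀ k : ℕ, f x < k ↔ f y < k := fun k => by
    rw [← labelCode_le_iff, ← labelCode_le_iff, hxy]
  have hlabel : f x = f y := le_antisymm (Nat.lt_succ_iff.1 ((hle _).2 (Nat.lt_succ_self _)))
    (Nat.lt_succ_iff.1 ((hle _).1 (Nat.lt_succ_self _)))
  unfold labelCode at hxy
  rw [hlabel, add_right_inj] at hxy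
  exact (measurableEmbedding_embeddingReal X).injective (Real.sigmoid_injective hxy)

theorem exists_measurableEquiv_mem_Icc_of_label [StandardBorelSpace X] (μ : Measure X)
    [IsProbabilityMeasure μ] [NullSingletonClass μ] {f : X → ℕ} (hf : Measurable f) :
    ∃ e : X ≃ᵐ ℝ, MeasurePreserving e μ (volume.restrict (Icc (0 : ℝ) 1)) ∧
      ∀ᵐ x ∂μ, e x ∈ Icc (μ.real (f ⁻¹' Iio (f x))) (μ.real (f ⁻¹' Iio (f x + 1))) := by
  have hV := measurableEmbedding_labelCode hf
  have := Measure.isProbabilityMeasure_map (μ := μ) hV.measurable.aemeasurable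
  have hcdf : ∀ k : ℕ, cdf (μ.map (labelCode f)) k = μ.real (f ⁻¹' Iio k) := by
    intro k
    rw [cdf_eq_real, map_measureReal_apply hV.measurable measurableSet_Iic]
    congr 1
    ext x
    exact labelCode_le_iff f x k
  have hmono := monotone_cdf (μ.map (labelCode f))
  obtain ⟨e, he, hmp⟩ := exists_measurableEquiv_ae_eq_cdf μ hV
  refine ⟨e, hmp, he.mono fun x hx => ?_⟩
  rw [hx, ← hcdf, ← hcdf]
  exact ⟨hmono (not_le.1 fun h => lt_irrefl _ ((labelCode_le_iff f x _).1 h)).le,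
    hmono ((labelCode_le_iff f x _).2 (Nat.lt_succ_self _))⟩

theorem eq_of_mem_Icc_of_notMem_range {G : ℕ → ℝ} (hG : Monotone G) {t : ℝ} (ht : t ∉ range G)
    {k l : ℕ} (hk : t ∈ Icc (G k) (G (k + 1))) (hl : t ∈ Icc (G l) (G (l + 1))) : k = l := by
  have hne : ∀ n, G n ≠ t := fun n h => ht ⟨n, h⟩
  have hle : ∀ m n, t ∈ Icc (G m) (G (m + 1)) → t ∈ Icc (G n) (G (n + 1)) → m ≤ n :=
    fun m n hm hn => Nat.lt_succ_iff.1 (hG.reflect_lt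
      ((hm.1.lt_of_ne (hne m)).trans (hn.2.lt_of_ne' (hne (n + 1)))))
  exact le_antisymm (hle k l hk hl) (hle l k hl hk)

theorem exists_measurePreserving_equiv_of_label [StandardBorelSpace X] [StandardBorelSpace Y]
    (μ : Measure X) (ν : Measure Y) [IsProbabilityMeasure μ] [IsProbabilityMeasure ν]
    [NullSingletonClass μ] [NullSingletonClass ν] {ι : Type*} [Countable ι]
    [MeasurableSpace ι] [DiscreteMeasurableSpace ι] {f : X → ι} {g : Y → ι} (hf : Measurable f)
    (hg : Measurable g) (hfg : μ.map f = ν.map g) :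
    ∃ e : X ≃ᵐ Y, MeasurePreserving e μ ν ∧ ∀ᵐ x ∂μ, g (e x) = f x := by
  obtain ⟨c, hc⟩ := Countable.exists_injective_nat ι
  have hcf : Measurable (c ∘ f) := (Measurable.of_discrete (f := c)).comp hf
  have hcg : Measurable (c ∘ g) := (Measurable.of_discrete (f := c)).comp hg
  have hlaw : ∀ k, ν.real (c ∘ g ⁻¹' Iio k) = μ.real (c ∘ f ⁻¹' Iio k) := fun k => by
    rw [preimage_comp, preimage_comp, ← map_measureReal_apply hg .of_discrete, ← hfg,
      map_measureReal_apply hf .of_discrete]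
  obtain ⟨e, he, hef⟩ := exists_measurableEquiv_mem_Icc_of_label μ hcf
  obtain ⟨e', he', heg⟩ := exists_measurableEquiv_mem_Icc_of_label ν hcg
  have hφ : MeasurePreserving (e.trans e'.symm) μ ν := (he'.symm e').comp he
  refine ⟨e.trans e'.symm, hφ, ?_⟩
  have hrange : ∀ᵐ t ∂volume.restrict (Icc (0 : ℝ) 1),
      t ∉ range fun k => μ.real (c ∘ f ⁻¹' Iio k) :=
    measure_eq_zero_iff_ae_notMem.1 ((countable_range _).measure_zero _)
  filter_upwards [hef, hφ.quasiMeasurePreserving.ae heg, he.quasiMeasurePreserving.ae hrange]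
    with x hx hx' hx''
  simp only [MeasurableEquiv.trans_apply, MeasurableEquiv.apply_symm_apply, hlaw] at hx'
  exact hc (eq_of_mem_Icc_of_notMem_range
    (fun k l hkl => measureReal_mono (preimage_mono (Iio_subset_Iio hkl))) hx'' hx' hx)

end Isomorphism

/-! ### Weak convergence of automorphisms -/

section Convergence

variable {X : Type*} [MeasurableSpace X] {μ : Measure X}

theorem imageDist_mk (B : Set X) (S T : mpGroup μ) :
    imageDist μ B (S : Aut μ) (T : Aut μ) =
      μ.real (((S : Equiv.Perm X) '' B) ∆ ((T : Equiv.Perm X) '' B)) := rfl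

theorem imageDist_inv_mk (B : Set X) (S T : mpGroup μ) :
    imageDist μ B (S : Aut μ)⁻¹ (T : Aut μ)⁻¹ =
      μ.real (((S : Equiv.Perm X) ⁻¹' B) ∆ ((T : Equiv.Perm X) ⁻¹' B)) := by
  rw [← QuotientGroup.mk_inv, ← QuotientGroup.mk_inv, imageDist_mk, Subgroup.coe_inv,
    Subgroup.coe_inv, Equiv.Perm.inv_def, Equiv.Perm.inv_def, Equiv.image_symm_eq_preimage,
    Equiv.image_symm_eq_preimage]

theorem measurableSet_image_mpGroup (S : mpGroup μ) {B : Set X} (hB : MeasurableSet B) :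
    MeasurableSet ((S : Equiv.Perm X) '' B) := by
  rw [Equiv.image_eq_preimage_symm]
  exact S.2.2.measurable hB

theorem measureReal_image_symmDiff (S : mpGroup μ) {B C : Set X} (hB : MeasurableSet B)
    (hC : MeasurableSet C) :
    μ.real (((S : Equiv.Perm X) '' B) ∆ ((S : Equiv.Perm X) '' C)) = μ.real (B ∆ C) := by
  rw [← image_symmDiff (S : Equiv.Perm X).injective, measureReal_image μ S (hB.symmDiff hC)]

theorem imageDist_image_inv (S : Aut μ) (T : mpGroup μ) {B : Set X} (hB : MeasurableSet B) :
    imageDist μ ((T : Equiv.Perm X) '' B) S⁻¹ (T : Aut μ)⁻¹ = imageDist μ B S T := by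
  obtain ⟨S, rfl⟩ := QuotientGroup.mk_surjective S
  have hTB := measurableSet_image_mpGroup T hB
  rw [imageDist_inv_mk, preimage_image_eq _ (Equiv.injective _), imageDist_mk, symmDiff_comm,
    ← measureReal_image_symmDiff S hB (S.2.1.measurable hTB),
    image_preimage_eq _ (Equiv.surjective _)]

/-- Weak convergence `u → S` along a filter: `μ(u B ∆ S B) → 0` for every measurable set `B`.
This is the convergence of the Halmos metric, independently of the dense sequence. -/
def WeakTendsto {α : Type*} (u : α → Aut μ) (l : Filter α) (S : Aut μ) : Prop :=
  ∀ B, MeasurableSet B → Tendsto (fun a => imageDist μ B (u a) S) l (𝓝 0)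

theorem WeakTendsto.inv {α : Type*} {l : Filter α} {u : α → Aut μ} {S : Aut μ}
    (h : WeakTendsto u l S) : WeakTendsto (fun a => (u a)⁻¹) l S⁻¹ := by
  obtain ⟨S, rfl⟩ := QuotientGroup.mk_surjective S
  intro B hB
  have hflip := fun a => imageDist_image_inv (u a) S (S.2.1.measurable hB)
  simp only [image_preimage_eq _ (Equiv.surjective _)] at hflip
  simpa only [hflip] using h _ (S.2.1.measurable hB)

/-- The partition `⋁_{p ∈ F} S^p ξ`, whose entropy defines `meanEntropy μ F ξ S`. -/
abbrev orbitJoin (F : Finset ℤ) {n : ℕ} (ξ : MeasPartition X (Fin n)) (S : mpGroup μ) :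
    MeasPartition X (F → Fin n) :=
  MeasPartition.join fun p : F => ξ.image (S ^ (p : ℤ))

theorem meanEntropy_mk (F : Finset ℤ) {n : ℕ} (ξ : MeasPartition X (Fin n)) (S : mpGroup μ) :
    meanEntropy μ F ξ (S : Aut μ) = (1 / (F.card : ℝ)) * (orbitJoin F ξ S).entropy μ := rfl

variable [IsFiniteMeasure μ]

theorem imageDist_mul_le (U S : Aut μ) (V T : mpGroup μ) {B : Set X} (hB : MeasurableSet B) :
    imageDist μ B (U * V) (S * T) ≤
      imageDist μ ((T : Equiv.Perm X) '' B) U S + imageDist μ B V T := by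
  obtain ⟨U, rfl⟩ := QuotientGroup.mk_surjective U
  obtain ⟨S, rfl⟩ := QuotientGroup.mk_surjective S
  rw [← QuotientGroup.mk_mul, ← QuotientGroup.mk_mul, imageDist_mk, imageDist_mk, imageDist_mk,
    Subgroup.coe_mul, Subgroup.coe_mul, Equiv.Perm.coe_mul, Equiv.Perm.coe_mul, image_comp,
    image_comp, add_comm, ← measureReal_image_symmDiff U (measurableSet_image_mpGroup V hB)
      (measurableSet_image_mpGroup T hB)]
  exact measureReal_symmDiff_le _

theorem imageDist_le_add (S T : Aut μ) {B C : Set X} (hB : MeasurableSet B)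
    (hC : MeasurableSet C) : imageDist μ B S T ≤ imageDist μ C S T + 2 * μ.real (C ∆ B) := by
  obtain ⟨S, rfl⟩ := QuotientGroup.mk_surjective S
  obtain ⟨T, rfl⟩ := QuotientGroup.mk_surjective T
  rw [imageDist_mk, imageDist_mk]
  have hS := measureReal_image_symmDiff S hB hC
  have hT := measureReal_image_symmDiff T hC hB
  rw [symmDiff_comm B C] at hS
  have hSC := measureReal_symmDiff_le (μ := μ) (s := (S : Equiv.Perm X) '' B)
    (t := (S : Equiv.Perm X) '' C) ((T : Equiv.Perm X) '' B)
  have hTC := measureReal_symmDiff_le (μ := μ) (s := (S : Equiv.Perm X) '' C)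
    (t := (T : Equiv.Perm X) '' C) ((T : Equiv.Perm X) '' B)
  linarith

theorem imageDist_le_halmosDist (A : ℕ → Set X) (i : ℕ) (S T : Aut μ) :
    imageDist μ (A i) S T ≤ 2 ^ i * halmosDist μ A S T := by
  have hle := (summable_halmos μ A S T).le_tsum i (fun j _ => mul_nonneg (by positivity)
    (add_nonneg (imageDist_nonneg μ (A j) S T) (imageDist_nonneg μ (A j) S⁻¹ T⁻¹)))
  rw [one_div_pow, div_mul_eq_mul_div, one_mul, div_le_iff₀' (by positivity)] at hle
  exact (le_add_of_nonneg_right (imageDist_nonneg _ _ _ _)).trans hle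

theorem tendsto_imageDist_of_isDenseSeq {A : ℕ → Set X} (hA : IsDenseSeq μ A) {α : Type*}
    {l : Filter α} {u v : α → Aut μ}
    (h : ∀ i, Tendsto (fun a => imageDist μ (A i) (u a) (v a)) l (𝓝 0)) {B : Set X}
    (hB : MeasurableSet B) : Tendsto (fun a => imageDist μ B (u a) (v a)) l (𝓝 0) := by
  refine Metric.tendsto_nhds.2 fun ε hε => ?_
  obtain ⟨i, hi⟩ := hA.exists_lt B hB (ε / 4) (by positivity)
  filter_upwards [(h i).eventually_lt_const (half_pos hε)] with a ha
  rw [Real.dist_eq, sub_zero, abs_of_nonneg (imageDist_nonneg _ _ _ _)]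
  linarith [imageDist_le_add (u a) (v a) hB (hA.measurableSet i)]

theorem tendsto_imageDist_of_tendsto_halmosDist {A : ℕ → Set X} (hA : IsDenseSeq μ A) {α : Type*}
    {l : Filter α} {u v : α → Aut μ}
    (h : Tendsto (fun a => halmosDist μ A (u a) (v a)) l (𝓝 0)) {B : Set X}
    (hB : MeasurableSet B) : Tendsto (fun a => imageDist μ B (u a) (v a)) l (𝓝 0) :=
  tendsto_imageDist_of_isDenseSeq hA (fun i => squeeze_zero
    (fun _ => imageDist_nonneg _ _ _ _) (fun _ => imageDist_le_halmosDist A i _ _)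
    (by simpa using h.const_mul (2 ^ i))) hB

namespace WeakTendsto

variable {α : Type*} {l : Filter α} {u v : α → Aut μ} {S T : Aut μ}

theorem mul (hu : WeakTendsto u l S) (hv : WeakTendsto v l T) :
    WeakTendsto (fun a => u a * v a) l (S * T) := by
  obtain ⟨T, rfl⟩ := QuotientGroup.mk_surjective T
  intro B hB
  refine squeeze_zero (fun a => imageDist_nonneg _ _ _ _) (fun a => ?_)
    (by simpa only [add_zero] using (hu _ (measurableSet_image_mpGroup T hB)).add (hv B hB))
  obtain ⟨V, hV⟩ := QuotientGroup.mk_surjective (v a)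
  simpa only [hV] using imageDist_mul_le (u a) S V T hB

theorem pow (h : WeakTendsto u l S) (n : ℕ) : WeakTendsto (fun a => u a ^ n) l (S ^ n) := by
  induction n with
  | zero => simpa [WeakTendsto, imageDist_self] using fun _ _ => tendsto_const_nhds
  | succ n ih => simpa only [pow_succ] using ih.mul h

theorem zpow (h : WeakTendsto u l S) (p : ℤ) : WeakTendsto (fun a => u a ^ p) l (S ^ p) := by
  obtain ⟨n, rfl | rfl⟩ := p.eq_nat_or_neg
  · simpa only [zpow_natCast] using h.pow n
  · simpa only [zpow_neg, zpow_natCast] using (h.pow n).inv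

theorem of_isDenseSeq {A : ℕ → Set X} (hA : IsDenseSeq μ A)
    (h : ∀ i, Tendsto (fun a => imageDist μ (A i) (u a) S) l (𝓝 0)) : WeakTendsto u l S :=
  fun _ hB => tendsto_imageDist_of_isDenseSeq hA h hB

theorem tendsto_halmosDist {A : ℕ → Set X} (hA : ∀ i, MeasurableSet (A i))
    (h : WeakTendsto u l S) : Tendsto (fun a => halmosDist μ A (u a) S) l (𝓝 0) := by
  have hlim := tendsto_tsum_of_dominated_convergence (𝓕 := l)
    (f := fun a i => (1 / 2 : ℝ) ^ i *
      (imageDist μ (A i) (u a) S + imageDist μ (A i) (u a)⁻¹ S⁻¹))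
    (g := fun _ => 0) (summable_geometric_two.mul_right (μ.real univ + μ.real univ))
    (fun i => by simpa using ((h _ (hA i)).add (h.inv _ (hA i))).const_mul ((1 / 2 : ℝ) ^ i))
    (Eventually.of_forall fun a i => by
      rw [Real.norm_of_nonneg (mul_nonneg (by positivity)
        (add_nonneg (imageDist_nonneg _ _ _ _) (imageDist_nonneg _ _ _ _)))]
      exact mul_le_mul_of_nonneg_left
        (add_le_add (imageDist_le _ _ _ _) (imageDist_le _ _ _ _)) (by positivity))
  simpa only [halmosDist, tsum_zero] using hlim

end WeakTendsto

theorem tendsto_nhds_halmosMetric_iff [StandardBorelSpace X] {A : ℕ → Set X}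
    (hA : IsDenseSeq μ A) {α : Type*} {l : Filter α} {u : α → Aut μ} {S : Aut μ} :
    letI := halmosMetric μ A hA
    Tendsto u l (𝓝 S) ↔ WeakTendsto u l S := by
  let _ := halmosMetric μ A hA
  rw [tendsto_iff_dist_tendsto_zero]
  exact ⟨fun h _ hB => tendsto_imageDist_of_tendsto_halmosDist hA h hB,
    fun h => h.tendsto_halmosDist hA.measurableSet⟩

theorem abs_measureReal_orbitJoin_sub_le (F : Finset ℤ) {n : ℕ} (ξ : MeasPartition X (Fin n))
    (S T : mpGroup μ) (a : F → Fin n) :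
    |μ.real ((orbitJoin F ξ S).cell a) - μ.real ((orbitJoin F ξ T).cell a)| ≤
      ∑ p : F, imageDist μ (ξ.cell (a p)) ((S : Aut μ) ^ (p : ℤ)) ((T : Aut μ) ^ (p : ℤ)) := by
  refine (abs_measureReal_sub_le_measureReal_symmDiff
    ((orbitJoin F ξ S).measurableSet_cell a).nullMeasurableSet
    ((orbitJoin F ξ T).measurableSet_cell a).nullMeasurableSet).trans ?_
  refine le_trans (measureReal_mono ?_) (measureReal_iUnion_fintype_le fun p : F =>
    (((S ^ (p : ℤ) : mpGroup μ) : Equiv.Perm X) '' ξ.cell (a p)) ∆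
      (((T ^ (p : ℤ) : mpGroup μ) : Equiv.Perm X) '' ξ.cell (a p)))
  intro x hx
  simp only [MeasPartition.join, MeasPartition.image, mem_symmDiff, mem_iInter, mem_iUnion]
    at hx ⊢
  grind

theorem tendsto_meanEntropy {α : Type*} {l : Filter α} {u : α → Aut μ} {S : Aut μ}
    (h : WeakTendsto u l S) (F : Finset ℤ) {n : ℕ} (ξ : MeasPartition X (Fin n)) :
    Tendsto (fun a => meanEntropy μ F ξ (u a)) l (𝓝 (meanEntropy μ F ξ S)) := by
  obtain ⟨S, rfl⟩ := QuotientGroup.mk_surjective S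
  choose t ht using fun a => QuotientGroup.mk_surjective (s := nullGroup μ) (u a)
  obtain rfl : (fun a => (t a : Aut μ)) = u := funext ht
  have hcell (b : F → Fin n) : Tendsto (fun a => μ.real ((orbitJoin F ξ (t a)).cell b)) l
      (𝓝 (μ.real ((orbitJoin F ξ S).cell b))) := by
    rw [tendsto_iff_dist_tendsto_zero]
    refine squeeze_zero (fun a => dist_nonneg)
      (fun a => abs_measureReal_orbitJoin_sub_le F ξ (t a) S b) ?_
    simpa only [Finset.sum_const_zero] using tendsto_finsetSum Finset.univ fun (p : F) _ =>
      h.zpow p _ (ξ.measurableSet_cell (b p))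
  simp_rw [meanEntropy_mk, MeasPartition.entropy]
  exact (Tendsto.neg (tendsto_finsetSum _ fun b _ =>
    (Real.continuous_mul_log.tendsto _).comp (hcell b))).const_mul _

theorem continuous_meanEntropy [StandardBorelSpace X] {A : ℕ → Set X} (hA : IsDenseSeq μ A)
    (F : Finset ℤ) {n : ℕ} (ξ : MeasPartition X (Fin n)) :
    letI := halmosMetric μ A hA
    Continuous (meanEntropy μ F ξ) := by
  let _ := halmosMetric μ A hA
  exact continuous_iff_continuousAt.2 fun _ =>
    tendsto_meanEntropy ((tendsto_nhds_halmosMetric_iff hA).1 tendsto_id) F ξ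

end Convergence

/-! ### Completeness of the Halmos metric -/

section Completeness

variable {X Y : Type*} [MeasurableSpace X] [MeasurableSpace Y] {μ : Measure X} {ν : Measure Y}

theorem symmDiff_limsup_subset {β : Type*} (C : ℕ → Set β) (N : ℕ) :
    C N ∆ limsup C atTop ⊆ ⋃ k, C (N + k) ∆ C (N + (k + 1)) := by
  intro x hx
  by_contra hconst
  simp only [mem_iUnion, mem_symmDiff, not_exists] at hconst
  have hmem (k : ℕ) : x ∈ C (N + k) ↔ x ∈ C N := by
    induction k with
    | zero => rfl
    | succ k ih => have := hconst k; tauto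
  have hlim : x ∈ limsup C atTop ↔ x ∈ C N := by
    rw [mem_limsup_iff_frequently_mem]
    refine ⟨fun h => ?_, fun h => ((eventually_ge_atTop N).mono fun n hn => ?_).frequently⟩
    · obtain ⟨n, hn, hx⟩ := frequently_atTop.1 h N
      exact (hmem (n - N)).1 (by rwa [Nat.add_sub_cancel' hn])
    · simpa only [Nat.add_sub_cancel' hn] using (hmem (n - N)).2 h
  rw [mem_symmDiff] at hx
  tauto

theorem completeSpace_measuredSets (μ : Measure X) : CompleteSpace (MeasuredSets μ) := by
  refine EMetric.complete_of_convergent_controlled_sequences (fun n => 2⁻¹ ^ n)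
    (fun n => ENNReal.pow_pos (by simp) n) fun u hu => ?_
  let C : ℕ → Set X := fun n => u n
  refine ⟨⟨limsup C atTop, .measurableSet_limsup fun n => (u n).2⟩, ?_⟩
  have hle (N : ℕ) : μ (C N ∆ limsup C atTop) ≤ 2⁻¹ ^ N * 2 := calc
    μ (C N ∆ limsup C atTop) ≤ ∑' k, μ (C (N + k) ∆ C (N + (k + 1))) :=
      (measure_mono (symmDiff_limsup_subset C N)).trans (measure_iUnion_le _)
    _ ≤ ∑' k, 2⁻¹ ^ (N + k) := ENNReal.tsum_le_tsum fun k =>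
      (hu (N + k) (N + k) (N + (k + 1)) le_rfl (by omega)).le
    _ = 2⁻¹ ^ N * 2 := by
      simp only [pow_add, ENNReal.tsum_mul_left, ENNReal.tsum_geometric, ENNReal.one_sub_inv_two,
        inv_inv]
  refine tendsto_iff_edist_tendsto_0.2 (tendsto_of_tendsto_of_tendsto_of_le_of_le
    tendsto_const_nhds ?_ (fun _ => zero_le) hle)
  simpa using ENNReal.Tendsto.mul_const (ENNReal.tendsto_pow_atTop_nhds_zero_of_lt_one
    (r := 2⁻¹) (by simp)) (Or.inr ENNReal.ofNat_ne_top)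

theorem measurable_pi_bool {ι : Type*} {f : X → ι → Bool}
    (h : ∀ i, MeasurableSet {x | f x i = true}) : Measurable f :=
  measurable_pi_iff.2 fun i => measurable_to_bool (h i)

theorem generateFrom_coord_eq_true {ι : Type*} (e : Y ≃ᵐ (ι → Bool)) :
    ‹MeasurableSpace Y› = MeasurableSpace.generateFrom (range fun i => {y | e y i = true}) := by
  refine le_antisymm (e.measurableEmbedding.comap_eq.symm.trans_le ?_)
    (MeasurableSpace.generateFrom_le ?_)
  · exact measurable_iff_comap_le.1 (@measurable_pi_bool _ (.generateFrom _) _ _ fun i =>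
      .basic _ ⟨i, rfl⟩)
  · rintro _ ⟨i, rfl⟩
    exact ((measurable_pi_apply i).comp e.measurable) (measurableSet_singleton true)

theorem tendsto_measure_iUnion_sdiff_accumulate [IsFiniteMeasure μ] {B : ℕ → Set X}
    (hB : ∀ i, MeasurableSet (B i)) :
    Tendsto (fun N => μ ((⋃ i, B i) \ accumulate B N)) atTop (𝓝 0) := by
  have hlim := tendsto_measure_iInter_atTop (μ := μ) (s := fun N => (⋃ i, B i) \ accumulate B N)
    (fun N => ((MeasurableSet.iUnion hB).diff
      (.biUnion (to_countable _) fun i _ => hB i)).nullMeasurableSet)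
    (fun M N h => sdiff_subset_sdiff_right (monotone_accumulate h)) ⟨0, measure_ne_top _ _⟩
  rwa [← sdiff_iUnion, iUnion_accumulate, sdiff_self, measure_empty] at hlim

theorem symmDiff_preimage_iUnion_subset {β γ : Type*} (f g : β → γ) (B : ℕ → Set γ) (N : ℕ) :
    (f ⁻¹' ⋃ i, B i) ∆ (g ⁻¹' ⋃ i, B i) ⊆
      (⋃ i ∈ Finset.range (N + 1), (f ⁻¹' B i) ∆ (g ⁻¹' B i)) ∪
        (f ⁻¹' ((⋃ i, B i) \ accumulate B N) ∪ g ⁻¹' ((⋃ i, B i) \ accumulate B N)) := by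
  intro x hx
  simp only [mem_symmDiff, mem_union, mem_preimage, mem_iUnion, Finset.mem_range, Set.mem_sdiff,
    mem_accumulate, Nat.lt_succ_iff, exists_prop] at hx ⊢
  grind

theorem tendsto_measure_symmDiff_preimage_iUnion [IsFiniteMeasure μ] [IsFiniteMeasure ν]
    {α : Type*} {l : Filter α} {t : α → X → Y} {g : X → Y}
    (ht : ∀ a, MeasurePreserving (t a) μ ν) (hg : Measurable g) {B : ℕ → Set Y}
    (hB : ∀ i, MeasurableSet (B i))
    (h : ∀ i, Tendsto (fun a => μ ((t a ⁻¹' B i) ∆ (g ⁻¹' B i))) l (𝓝 0)) :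
    Tendsto (fun a => μ ((t a ⁻¹' ⋃ i, B i) ∆ (g ⁻¹' ⋃ i, B i))) l (𝓝 0) := by
  refine ENNReal.tendsto_nhds_zero.2 fun ε hε => ?_
  let D : ℕ → Set Y := fun N => (⋃ i, B i) \ accumulate B N
  have htail : Tendsto (fun N => ν (D N) + μ.map g (D N)) atTop (𝓝 0) := by
    simpa using (tendsto_measure_iUnion_sdiff_accumulate (μ := ν) hB).add
      (tendsto_measure_iUnion_sdiff_accumulate (μ := μ.map g) hB)
  obtain ⟨N, hN⟩ := (ENNReal.tendsto_nhds_zero.1 htail _ (ENNReal.half_pos hε.ne')).exists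
  have hD : MeasurableSet (D N) :=
    (MeasurableSet.iUnion hB).diff (.biUnion (to_countable _) fun i _ => hB i)
  have hhead : Tendsto (fun a => ∑ i ∈ Finset.range (N + 1), μ ((t a ⁻¹' B i) ∆ (g ⁻¹' B i)))
      l (𝓝 0) := by
    simpa using tendsto_finsetSum (Finset.range (N + 1)) fun i _ => h i
  filter_upwards [ENNReal.tendsto_nhds_zero.1 hhead _ (ENNReal.half_pos hε.ne')] with a ha
  calc μ ((t a ⁻¹' ⋃ i, B i) ∆ (g ⁻¹' ⋃ i, B i))
      ≤ ∑ i ∈ Finset.range (N + 1), μ ((t a ⁻¹' B i) ∆ (g ⁻¹' B i)) +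
        (μ (t a ⁻¹' D N) + μ (g ⁻¹' D N)) :=
      (measure_mono (symmDiff_preimage_iUnion_subset _ _ B N)).trans <|
        (measure_union_le _ _).trans <|
          add_le_add (measure_biUnion_finset_le _ _) (measure_union_le _ _)
    _ ≤ ε / 2 + ε / 2 := by
      rw [(ht a).measure_preimage hD.nullMeasurableSet, ← Measure.map_apply hg hD]
      exact add_le_add ha hN
    _ = ε := ENNReal.add_halves ε

theorem tendsto_measure_symmDiff_preimage_of_generateFrom [IsFiniteMeasure μ] [IsFiniteMeasure ν]
    {α : Type*} {l : Filter α} {t : α → X → Y} {g : X → Y}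
    (ht : ∀ a, MeasurePreserving (t a) μ ν) (hg : Measurable g) {G : Set (Set Y)}
    (hG : ‹MeasurableSpace Y› = .generateFrom G)
    (h : ∀ B ∈ G, Tendsto (fun a => μ ((t a ⁻¹' B) ∆ (g ⁻¹' B))) l (𝓝 0)) {B : Set Y}
    (hB : MeasurableSet B) : Tendsto (fun a => μ ((t a ⁻¹' B) ∆ (g ⁻¹' B))) l (𝓝 0) := by
  rw [hG] at hB
  induction B, hB using MeasurableSpace.generateFrom_induction with
  | hC B hB => exact h B hB
  | empty => simpa using tendsto_const_nhds
  | compl B _ ih => simpa only [preimage_compl, compl_symmDiff_compl] using ih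
  | iUnion B hB ih =>
    exact tendsto_measure_symmDiff_preimage_iUnion ht hg (fun i => by rw [hG]; exact hB i) ih

theorem exists_measurePreserving_limit [IsFiniteMeasure μ] [IsFiniteMeasure ν]
    [StandardBorelSpace Y] [Uncountable Y] {t : ℕ → X → Y}
    (ht : ∀ n, MeasurePreserving (t n) μ ν)
    (hcauchy : ∀ B, MeasurableSet B →
      Tendsto (fun q : ℕ × ℕ => μ.real ((t q.1 ⁻¹' B) ∆ (t q.2 ⁻¹' B))) atTop (𝓝 0)) :
    ∃ g, MeasurePreserving g μ ν ∧ ∀ B, MeasurableSet B →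
      Tendsto (fun n => μ ((t n ⁻¹' B) ∆ (g ⁻¹' B))) atTop (𝓝 0) := by
  have := completeSpace_measuredSets μ
  let e : Y ≃ᵐ (ℕ → Bool) := PolishSpace.measurableEquivNatBoolOfNotCountable not_countable
  have hcoord (i : ℕ) : MeasurableSet {y | e y i = true} :=
    ((measurable_pi_apply i).comp e.measurable) (measurableSet_singleton true)
  have hlim (i : ℕ) : ∃ C : MeasuredSets μ,
      Tendsto (fun n => μ ((t n ⁻¹' {y | e y i = true}) ∆ C)) atTop (𝓝 0) := by
    let u : ℕ → MeasuredSets μ := fun n => ⟨_, (ht n).measurable (hcoord i)⟩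
    have hu : CauchySeq u := by
      rw [cauchySeq_iff_tendsto_dist_atTop_0]
      exact (hcauchy _ (hcoord i)).congr fun q => (MeasuredSets.dist_def (u q.1) (u q.2)).symm
    obtain ⟨C, hC⟩ := cauchySeq_tendsto_of_complete hu
    exact ⟨C, tendsto_iff_edist_tendsto_0.1 hC⟩
  choose C hC using hlim
  classical
  let g : X → Y := fun x => e.symm fun i => decide (x ∈ (C i : Set X))
  have hgC (i : ℕ) : g ⁻¹' {y | e y i = true} = C i := by ext x; simp [g]
  have hg : Measurable g := e.symm.measurable.comp <| measurable_pi_bool fun i => by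
    simp only [decide_eq_true_eq]
    exact (C i).2
  have hconv {B : Set Y} (hB : MeasurableSet B) :
      Tendsto (fun n => μ ((t n ⁻¹' B) ∆ (g ⁻¹' B))) atTop (𝓝 0) :=
    tendsto_measure_symmDiff_preimage_of_generateFrom ht hg (generateFrom_coord_eq_true e)
      (forall_mem_range.2 fun i => by simpa only [hgC] using hC i) hB
  refine ⟨g, ⟨hg, Measure.ext fun B hB => ?_⟩, fun B hB => hconv hB⟩
  let u : ℕ → MeasuredSets μ := fun n => ⟨_, (ht n).measurable hB⟩
  have hu : Tendsto u atTop (𝓝 ⟨g ⁻¹' B, hg hB⟩) := tendsto_iff_edist_tendsto_0.2 (hconv hB)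
  have hmeas := (MeasuredSets.continuous_measure.tendsto _).comp hu
  rw [Measure.map_apply hg hB]
  refine tendsto_nhds_unique hmeas (tendsto_const_nhds.congr fun n => ?_)
  exact ((ht n).measure_preimage hB.nullMeasurableSet).symm

theorem measureReal_symmDiff_preimage {f : X → Y} (hf : MeasurePreserving f μ ν) {B C : Set Y}
    (hB : MeasurableSet B) (hC : MeasurableSet C) :
    μ.real ((f ⁻¹' B) ∆ (f ⁻¹' C)) = ν.real (B ∆ C) := by
  rw [← preimage_symmDiff, hf.measureReal_preimage (hB.symmDiff hC).nullMeasurableSet]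

theorem ae_comp_eq_self_of_tendsto {α : Type*} {l : Filter α} [l.NeBot] [StandardBorelSpace X]
    {t : α → mpGroup μ} {g h : X → X} (hh : Measurable h)
    (htg : ∀ B, MeasurableSet B →
      Tendsto (fun a => μ (((t a : Equiv.Perm X) ⁻¹' B) ∆ (g ⁻¹' B))) l (𝓝 0))
    (hth : ∀ B, MeasurableSet B →
      Tendsto (fun a => μ (((t a : Equiv.Perm X).symm ⁻¹' B) ∆ (h ⁻¹' B))) l (𝓝 0)) :
    ∀ᵐ x ∂μ, h (g x) = x := by
  suffices h ∘ g =ᵐ[μ] id from this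
  refine Filter.EventuallyEq.of_forall_separating_preimage (p := MeasurableSet) fun B hB => ?_
  rw [← measure_symmDiff_eq_zero_iff, preimage_id, preimage_comp, symmDiff_comm,
    ← nonpos_iff_eq_zero]
  have hhB := hh hB
  refine ge_of_tendsto (by simpa using (hth B hB).add (htg _ hhB)) (.of_forall fun a => ?_)
  let C : Set X := (t a : Equiv.Perm X) ⁻¹' (h ⁻¹' B)
  calc μ (B ∆ (g ⁻¹' (h ⁻¹' B))) ≤ μ (B ∆ C) + μ (C ∆ (g ⁻¹' (h ⁻¹' B))) :=
      measure_symmDiff_le _ _ _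
    _ = μ (((t a : Equiv.Perm X).symm ⁻¹' B) ∆ (h ⁻¹' B)) + μ (C ∆ (g ⁻¹' (h ⁻¹' B))) := by
      rw [← (t a).2.1.measure_preimage
        (((t a).2.2.measurable hB).symmDiff hhB).nullMeasurableSet, preimage_symmDiff,
        Equiv.preimage_symm_preimage]

/-- The element of `mpGroup μ` given by a measure-preserving measurable equivalence. -/
def mpGroup.ofMeasurableEquiv (e : X ≃ᵐ X) (he : MeasurePreserving e μ μ) : mpGroup μ :=
  ⟨e.toEquiv, he, he.symm e⟩

theorem halmosDist_inv (A : ℕ → Set X) (S T : Aut μ) :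
    halmosDist μ A S⁻¹ T⁻¹ = halmosDist μ A S T := by
  simp only [halmosDist, inv_inv, add_comm]

theorem exists_weakTendsto [IsFiniteMeasure μ] [NeZero μ] [NullSingletonClass μ]
    [StandardBorelSpace X] {s : ℕ → mpGroup μ}
    (hs : ∀ B, MeasurableSet B → Tendsto
      (fun q : ℕ × ℕ => imageDist μ B (s q.1) (s q.2)) atTop (𝓝 0))
    (hs' : ∀ B, MeasurableSet B → Tendsto
      (fun q : ℕ × ℕ => imageDist μ B (s q.1 : Aut μ)⁻¹ (s q.2 : Aut μ)⁻¹) atTop (𝓝 0)) :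
    ∃ S : mpGroup μ, WeakTendsto (fun n => (s n : Aut μ)) atTop S := by
  have := uncountable_of_nullSingletonClass μ
  obtain ⟨g, hg, hsg⟩ := exists_measurePreserving_limit (fun n => (s n).2.1)
    (by simpa only [imageDist_inv_mk] using hs')
  obtain ⟨h, hh, hsh⟩ := exists_measurePreserving_limit (fun n => (s n).2.2)
    (by simpa only [imageDist_mk, Equiv.image_eq_preimage_symm] using hs)
  have hhg : ∀ᵐ x ∂μ, h (g x) = x := ae_comp_eq_self_of_tendsto hh.measurable hsg hsh
  obtain ⟨e, he⟩ := exists_measurableEquiv_ae_eq_of_injOn hg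
    (measurableSet_eq_fun (hh.measurable.comp hg.measurable) measurable_id) (ae_iff.1 hhg)
    fun x hx y hy hxy => by
      simp only [mem_ofPred_eq, Function.comp_apply, id] at hx hy
      rw [← hx, ← hy, hxy]
  let S := mpGroup.ofMeasurableEquiv e (hg.congr e.measurable he.symm)
  have hinv : WeakTendsto (fun n => (s n : Aut μ)⁻¹) atTop (S : Aut μ)⁻¹ := fun B hB => by
    have hBe : (S : Equiv.Perm X) ⁻¹' B =ᵐ[μ] g ⁻¹' B := he.preimage B
    simp_rw [imageDist_inv_mk]
    exact (ENNReal.tendsto_toReal_zero_iff (fun _ => measure_ne_top _ _)).2 <| (hsg B hB).congr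
      fun n => measure_congr (ae_eq_set_symmDiff (ae_eq_refl _) hBe.symm)
  exact ⟨S, by simpa only [inv_inv] using hinv.inv⟩

theorem completeSpace_halmosMetric [IsFiniteMeasure μ] [NeZero μ] [NullSingletonClass μ]
    [StandardBorelSpace X] {A : ℕ → Set X} (hA : IsDenseSeq μ A) :
    letI := halmosMetric μ A hA
    CompleteSpace (Aut μ) := by
  let _ := halmosMetric μ A hA
  refine Metric.complete_of_cauchySeq_tendsto fun u hu => ?_
  choose s hs using fun n => QuotientGroup.mk_surjective (s := nullGroup μ) (u n)
  obtain rfl : (fun n => (s n : Aut μ)) = u := funext hs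
  have hdist : Tendsto (fun q : ℕ × ℕ => halmosDist μ A (s q.1) (s q.2)) atTop (𝓝 0) :=
    cauchySeq_iff_tendsto_dist_atTop_0.1 hu
  obtain ⟨S, hS⟩ := exists_weakTendsto
    (fun _ hB => tendsto_imageDist_of_tendsto_halmosDist hA hdist hB)
    (fun _ hB => tendsto_imageDist_of_tendsto_halmosDist hA
      (by simpa only [halmosDist_inv] using hdist) hB)
  exact ⟨S, (tendsto_nhds_halmosMetric_iff hA).2 hS⟩

end Completeness

/-! ### Block paths -/

section BlockPath

open ProbabilityTheory

theorem uniformOn_univ_real_singleton {ι : Type*} [Fintype ι] [MeasurableSpace ι]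
    [MeasurableSingletonClass ι] (i : ι) :
    (uniformOn (univ : Set ι)).real {i} = 1 / Fintype.card ι := by
  simp [Measure.real, uniformOn_univ]

theorem measurePreserving_uniformOn_univ {ι : Type*} [Finite ι] [MeasurableSpace ι]
    [DiscreteMeasurableSpace ι] (e : Equiv.Perm ι) :
    MeasurePreserving e (uniformOn univ) (uniformOn univ) := by
  have := Fintype.ofFinite ι
  refine ⟨.of_discrete, Measure.ext_of_singleton fun i => ?_⟩
  rw [Measure.map_apply .of_discrete (measurableSet_singleton _), ← e.image_symm_eq_preimage]
  simp [uniformOn_univ]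

variable {X : Type*} [MeasurableSpace X] {μ : Measure X}

/-- The shift of the space of two-sided sequences. -/
def shift (X : Type*) [MeasurableSpace X] : (ℤ → X) ≃ᵐ (ℤ → X) :=
  (MeasurableEquiv.piCongrLeft (fun _ => X) (Equiv.addRight 1)).symm

theorem shift_apply (x : ℤ → X) (n : ℤ) : shift X x n = x (n + 1) := rfl

/-- From a phase `u` and a sequence `z` of points, the path that runs through the orbit segments
`z k, S (z k), …, S ^ (M - 1) (z k)` one after the other, started at time `u` of the segment of
`z 0`. -/
def blockPath (S : mpGroup μ) {M : ℕ} (y : Fin M × (ℤ → X)) (n : ℤ) : X :=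
  ((S ^ ((y.1 + n) % M) : mpGroup μ) : Equiv.Perm X) (y.2 ((y.1 + n) / M))

theorem measurable_blockPath (S : mpGroup μ) (M : ℕ) :
    Measurable (blockPath S : Fin M × (ℤ → X) → ℤ → X) :=
  measurable_pi_iff.2 fun n => measurable_from_prod_countable_right fun u =>
    (S ^ ((u + n) % M : ℤ)).2.1.measurable.comp (measurable_pi_apply ((u + n) / M : ℤ))

theorem blockPath_mul (S : mpGroup μ) {M : ℕ} (y : Fin M × (ℤ → X)) (k : ℤ) :
    blockPath S y (k * M) = ((S ^ (y.1 : ℤ) : mpGroup μ) : Equiv.Perm X) (y.2 k) := by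
  have hM : (M : ℤ) ≠ 0 := by have := y.1.2; omega
  rw [blockPath, Int.add_mul_emod_self_right, Int.add_mul_ediv_right _ _ hM,
    Int.emod_eq_of_lt (by omega) (by omega), Int.ediv_eq_zero_of_lt (by omega) (by omega), zero_add]

/-- One unit of time of the block path: the phase is moved cyclically, and the sequence of
points is shifted when the phase returns to `0`. -/
def blockStep {M : ℕ} [NeZero M] (y : Fin M × (ℤ → X)) : Fin M × (ℤ → X) :=
  (y.1 + 1, if y.1 + 1 = 0 then shift X y.2 else y.2)

theorem fin_val_add_one_of_ne_zero {M : ℕ} [NeZero M] {u : Fin M} (hu : u + 1 ≠ 0) :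
    (u + 1).val = u.val + 1 := by
  refine Fin.val_add_one_of_lt' ((Nat.succ_le_of_lt u.2).lt_of_ne fun h => hu (Fin.ext ?_))
  rw [Fin.val_add, Fin.val_one', Nat.add_mod_mod, ← Nat.succ_eq_add_one, h, Nat.mod_self,
    Fin.val_zero]

theorem fin_val_add_one_of_eq_zero {M : ℕ} [NeZero M] {u : Fin M} (hu : u + 1 = 0) :
    u.val + 1 = M := by
  by_contra h
  simpa [hu] using Fin.val_add_one_of_lt' ((Nat.succ_le_of_lt u.2).lt_of_ne h)

theorem blockPath_blockStep (S : mpGroup μ) {M : ℕ} [NeZero M] (y : Fin M × (ℤ → X)) :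
    blockPath S (blockStep y) = shift X (blockPath S y) := by
  ext n
  by_cases hu : y.1 + 1 = 0
  · have hn : (y.1 : ℤ) + (n + 1) = n + M := by have := fin_val_add_one_of_eq_zero hu; omega
    have hM : (M : ℤ) ≠ 0 := by exact_mod_cast NeZero.ne M
    simp only [blockPath, blockStep, hu, if_true, hn, shift_apply, Fin.val_zero, Nat.cast_zero,
      zero_add, Int.add_emod_right, Int.add_ediv_of_dvd_right dvd_rfl, Int.ediv_self hM]
  · simp only [blockPath, blockStep, if_neg hu, shift_apply, fin_val_add_one_of_ne_zero hu,
      Nat.cast_add, Nat.cast_one, add_assoc, add_comm (1 : ℤ)]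

theorem blockPath_zero (S : mpGroup μ) {M : ℕ} (y : Fin M × (ℤ → X)) :
    blockPath S y 0 = ((S ^ (y.1 : ℕ) : mpGroup μ) : Equiv.Perm X) (y.2 0) := by
  simpa using blockPath_mul S y 0

theorem blockPath_one (S : mpGroup μ) {M : ℕ} [NeZero M] {y : Fin M × (ℤ → X)}
    (hy : y.1 + 1 ≠ 0) :
    blockPath S y 1 = (S : Equiv.Perm X) (blockPath S y 0) := by
  have hstep : blockPath S y 1 = blockPath S (blockStep y) 0 :=
    (congrFun (blockPath_blockStep S y) 0).symm
  rw [hstep, blockPath_zero, blockPath_zero, blockStep, if_neg hy,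
    fin_val_add_one_of_ne_zero hy, pow_succ', Subgroup.coe_mul, Equiv.Perm.mul_apply]

theorem measurePreserving_uncurry_snd {ι Z W : Type*} [Countable ι] [MeasurableSpace ι]
    [DiscreteMeasurableSpace ι] [MeasurableSpace Z] [MeasurableSpace W] {m : Measure ι}
    [IsProbabilityMeasure m] {ν : Measure Z} [SFinite ν] {ν' : Measure W} [SFinite ν']
    {g : ι → Z → W} (hg : ∀ i, MeasurePreserving (g i) ν ν') :
    MeasurePreserving (fun y : ι × Z => g y.1 y.2) (m.prod ν) ν' :=
  measurePreserving_snd.comp <| (MeasurePreserving.id m).skew_product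
    (measurable_from_prod_countable_right fun i => (hg i).measurable)
    (ae_of_all _ fun i => (hg i).map_eq)

variable [IsProbabilityMeasure μ]

theorem measurePreserving_shift_infinitePi :
    MeasurePreserving (shift X) (Measure.infinitePi fun _ => μ) (Measure.infinitePi fun _ => μ) :=
  MeasurePreserving.symm (MeasurableEquiv.piCongrLeft (fun _ => X) (Equiv.addRight (1 : ℤ)))
    ⟨MeasurableEquiv.measurable _, Measure.infinitePi_map_piCongrLeft (fun _ : ℤ => μ) _⟩

theorem measurePreserving_blockStep (M : ℕ) [NeZero M] :
    MeasurePreserving (blockStep : Fin M × (ℤ → X) → _)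
      ((uniformOn univ).prod (Measure.infinitePi fun _ => μ))
      ((uniformOn univ).prod (Measure.infinitePi fun _ => μ)) := by
  refine (measurePreserving_uniformOn_univ (Equiv.addRight (1 : Fin M))).skew_product
    (g := fun u z => if u + 1 = 0 then shift X z else z)
    (measurable_from_prod_countable_right fun u => ?_) (ae_of_all _ fun u => ?_)
  · by_cases hu : u + 1 = 0
    · simpa only [Function.uncurry_apply_pair, if_pos hu] using (shift X).measurable
    · simpa only [Function.uncurry_apply_pair, if_neg hu] using measurable_id'
  · by_cases hu : u + 1 = 0
    · simpa only [if_pos hu] using measurePreserving_shift_infinitePi.map_eq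
    · simpa only [if_neg hu] using Measure.map_id'

/-- The law of the block path with a uniformly distributed phase and independent points of
law `μ`. -/
def blockLaw (S : mpGroup μ) (M : ℕ) : Measure (ℤ → X) :=
  ((uniformOn (univ : Set (Fin M))).prod (Measure.infinitePi fun _ => μ)).map (blockPath S)

instance isProbabilityMeasure_blockLaw (S : mpGroup μ) (M : ℕ) [NeZero M] :
    IsProbabilityMeasure (blockLaw S M) :=
  Measure.isProbabilityMeasure_map (measurable_blockPath S M).aemeasurable

theorem measurePreserving_shift_blockLaw (S : mpGroup μ) (M : ℕ) [NeZero M] :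
    MeasurePreserving (shift X) (blockLaw S M) (blockLaw S M) :=
  .of_semiconj ((measurable_blockPath S M).measurePreserving _)
    (measurePreserving_blockStep M) (blockPath_blockStep S) (shift X).measurable

theorem measurePreserving_eval_blockLaw (S : mpGroup μ) (M : ℕ) [NeZero M] (n : ℤ) :
    MeasurePreserving (fun x : ℤ → X => x n) (blockLaw S M) μ := by
  refine .map_of_comp ?_ (measurable_pi_apply n) (measurable_blockPath S M)
  exact measurePreserving_uncurry_snd fun u : Fin M => (S ^ ((u + n) % M : ℤ)).2.1.comp
    (measurePreserving_eval_infinitePi (fun _ => μ) ((u + n) / M : ℤ))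

theorem measurePreserving_sample_blockLaw (S : mpGroup μ) (M : ℕ) [NeZero M] :
    MeasurePreserving (fun (x : ℤ → X) (k : ℤ) => x (k * M)) (blockLaw S M)
      (Measure.infinitePi fun _ => μ) := by
  refine .map_of_comp ?_ (measurable_pi_iff.2 fun k => measurable_pi_apply _)
    (measurable_blockPath S M)
  have hsample : (fun (x : ℤ → X) (k : ℤ) => x (k * M)) ∘ blockPath S =
      fun (y : Fin M × (ℤ → X)) k => ((S ^ (y.1 : ℤ) : mpGroup μ) : Equiv.Perm X) (y.2 k) :=
    funext fun y => funext (blockPath_mul S y)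
  rw [hsample]
  refine measurePreserving_uncurry_snd
    (g := fun (u : Fin M) (z : ℤ → X) k => ((S ^ (u : ℤ) : mpGroup μ) : Equiv.Perm X) (z k))
    fun u => ?_
  have hmeas := (S ^ (u : ℤ)).2.1.measurable
  refine ⟨measurable_pi_iff.2 fun k => hmeas.comp (measurable_pi_apply k), ?_⟩
  rw [Measure.infinitePi_map_pi _ fun _ => hmeas, (S ^ (u : ℤ)).2.1.map_eq]

theorem iIndepFun_sample_blockLaw (S : mpGroup μ) (M : ℕ) [NeZero M] :
    iIndepFun (fun (k : ℤ) (x : ℤ → X) => x (k * M)) (blockLaw S M) := by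
  rw [iIndepFun_iff_map_fun_eq_infinitePi_map fun k => measurable_pi_apply _,
    (measurePreserving_sample_blockLaw S M).map_eq]
  congr 1 with k : 1
  exact (measurePreserving_eval_blockLaw S M (k * M)).map_eq.symm

theorem measureReal_blockLaw_symmDiff_le (S : mpGroup μ) (M : ℕ) [NeZero M] {B : Set X}
    (hB : MeasurableSet B) :
    (blockLaw S M).real
      (((fun x => x 1) ⁻¹' B) ∆ ((fun x => x 0) ⁻¹' ((S : Equiv.Perm X) ⁻¹' B))) ≤ 1 / M := by
  set m := (uniformOn (univ : Set (Fin M))).prod (Measure.infinitePi fun _ : ℤ => μ)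
  have hjump : MeasurableSet
      (((fun x : ℤ → X => x 1) ⁻¹' B) ∆ ((fun x => x 0) ⁻¹' ((S : Equiv.Perm X) ⁻¹' B))) :=
    (measurable_pi_apply 1 hB).symmDiff (measurable_pi_apply 0 (S.2.1.measurable hB))
  calc (blockLaw S M).real
        (((fun x => x 1) ⁻¹' B) ∆ ((fun x => x 0) ⁻¹' ((S : Equiv.Perm X) ⁻¹' B)))
      = m.real (blockPath S ⁻¹'
          (((fun x => x 1) ⁻¹' B) ∆ ((fun x => x 0) ⁻¹' ((S : Equiv.Perm X) ⁻¹' B)))) :=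
        map_measureReal_apply (measurable_blockPath S M) hjump
    _ ≤ m.real (Prod.fst ⁻¹' {-1}) := measureReal_mono fun y hy => by
        by_contra hlast
        refine absurd hy ?_
        have hy1 : y.1 + 1 ≠ 0 := fun h => hlast (eq_neg_of_add_eq_zero_left h)
        simp [mem_symmDiff, blockPath_one S hy1]
    _ = (uniformOn (univ : Set (Fin M))).real {-1} :=
        measurePreserving_fst.measureReal_preimage (measurableSet_singleton _).nullMeasurableSet
    _ = 1 / M := by rw [uniformOn_univ_real_singleton, Fintype.card_fin]

end BlockPath

/-! ### Entropy of independent partitions -/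

section Entropy

theorem prod_mul_log_prod {κ : Type*} [Fintype κ] [DecidableEq κ] (x : κ → ℝ) :
    (∏ k, x k) * Real.log (∏ k, x k) = ∑ k, ∏ l, if l = k then x l * Real.log (x l) else x l := by
  have hterm (k : κ) :
      (∏ l, if l = k then x l * Real.log (x l) else x l) = (∏ l, x l) * Real.log (x k) := by
    rw [← Finset.mul_prod_erase _ _ (Finset.mem_univ k),
      ← Finset.mul_prod_erase _ x (Finset.mem_univ k), if_pos rfl,
      Finset.prod_congr rfl fun l hl => if_neg (Finset.ne_of_mem_erase hl)]
    ring
  simp_rw [hterm, ← Finset.mul_sum]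
  by_cases hx : ∏ k, x k = 0
  · rw [hx, zero_mul, zero_mul]
  · rw [Real.log_prod fun k hk => Finset.prod_ne_zero_iff.1 hx k hk]

variable {X : Type*} [MeasurableSpace X] {μ : Measure X}

namespace MeasPartition

theorem sum_measureReal_cell [IsProbabilityMeasure μ] {ι : Type*} [Fintype ι]
    (ξ : MeasPartition X ι) : ∑ i, μ.real (ξ.cell i) = 1 := by
  rw [← measureReal_iUnion_fintype ξ.disjoint ξ.measurableSet_cell, ξ.iUnion_cell,
    probReal_univ]

theorem entropy_image {ι : Type*} [Fintype ι] (S : mpGroup μ) (ξ : MeasPartition X ι) :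
    (ξ.image S).entropy μ = ξ.entropy μ := by
  simp only [entropy, image, measureReal_image μ S (ξ.measurableSet_cell _)]

/-- Independence of a finite family of partitions: every choice of one cell from each of them is
an independent family of events. -/
def Indep {ι κ : Type*} [Fintype κ] (μ : Measure X) (η : κ → MeasPartition X ι) : Prop :=
  ∀ a, μ.real ((join η).cell a) = ∏ k, μ.real ((η k).cell (a k))

theorem entropy_join_of_indep [IsProbabilityMeasure μ] {ι κ : Type*} [Fintype ι] [Fintype κ]
    [DecidableEq κ] {η : κ → MeasPartition X ι} (hη : Indep μ η) :
    (join η).entropy μ = ∑ k, (η k).entropy μ := by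
  simp only [entropy, hη _, prod_mul_log_prod, Finset.sum_neg_distrib]
  rw [Finset.sum_comm]
  congr 1
  refine Finset.sum_congr rfl fun k _ => ?_
  rw [← Fintype.prod_sum (fun l i => if l = k then
    μ.real ((η l).cell i) * Real.log (μ.real ((η l).cell i)) else μ.real ((η l).cell i)),
    ← Finset.mul_prod_erase _ _ (Finset.mem_univ k), Finset.prod_eq_one fun l hl => by
      simp only [if_neg (Finset.ne_of_mem_erase hl), sum_measureReal_cell]]
  simp only [if_true, mul_one]

end MeasPartition

theorem meanEntropy_of_indep [IsProbabilityMeasure μ] {F : Finset ℤ} (hF : F.Nonempty) {n : ℕ}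
    {ξ : MeasPartition X (Fin n)} {T : mpGroup μ}
    (hT : MeasPartition.Indep μ fun p : F => ξ.image (T ^ (p : ℤ))) :
    meanEntropy μ F ξ (T : Aut μ) = ξ.entropy μ := by
  have hcard : (F.card : ℝ) ≠ 0 := by exact_mod_cast hF.card_ne_zero
  rw [meanEntropy_mk, MeasPartition.entropy_join_of_indep hT]
  simp only [MeasPartition.entropy_image, Finset.sum_const, Finset.card_univ, Fintype.card_coe,
    nsmul_eq_mul]
  field_simp

end Entropy

/-! ### Approximation by block paths -/

section Approximation

open ProbabilityTheory

variable {X Y : Type*} [MeasurableSpace X] [MeasurableSpace Y] {μ : Measure X} {ν : Measure Y}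

theorem nullSingletonClass_of_measurePreserving [MeasurableSingletonClass X]
    [NullSingletonClass μ] {π : Y → X} (hπ : MeasurePreserving π ν μ) : NullSingletonClass ν := by
  refine ⟨fun y => measure_mono_null (t := π ⁻¹' {π y}) (by simp) ?_⟩
  rw [hπ.measure_preimage (measurableSet_singleton _).nullMeasurableSet, measure_singleton]

theorem exists_equiv_of_extension [StandardBorelSpace X] [StandardBorelSpace Y]
    [IsProbabilityMeasure μ] [NullSingletonClass μ] {π : Y → X} (hπ : MeasurePreserving π ν μ)
    {κ : Type*} [Finite κ] {D : κ → Set X} (hD : ∀ i, MeasurableSet (D i)) :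
    ∃ φ : X ≃ᵐ Y, MeasurePreserving φ μ ν ∧ ∀ i, (π ∘ φ) ⁻¹' D i =ᵐ[μ] D i := by
  classical
  have : IsProbabilityMeasure ν := ⟨by
    rw [← preimage_univ (f := π), hπ.measure_preimage MeasurableSet.univ.nullMeasurableSet,
      measure_univ]⟩
  have := nullSingletonClass_of_measurePreserving hπ
  let f : X → κ → Bool := fun x i => decide (x ∈ D i)
  have hf : Measurable f := measurable_pi_bool fun i => by simpa [f] using hD i
  obtain ⟨φ, hφ, hlabel⟩ := exists_measurePreserving_equiv_of_label μ ν hf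
    (hf.comp hπ.measurable) (by rw [← Measure.map_map hf hπ.measurable, hπ.map_eq])
  refine ⟨φ, hφ, fun i => eventuallyEq_set.2 ?_⟩
  filter_upwards [hlabel] with x hx
  simpa [f] using congrFun hx i

theorem apply_zpow_of_semiconj_shift {W : Type*} {T : Equiv.Perm W} {φ : W → ℤ → X}
    (hT : Function.Semiconj φ T (shift X)) (n : ℤ) (y : W) (k : ℤ) :
    φ ((T ^ n) y) k = φ y (k + n) := by
  have hone (y k) : φ (T y) k = φ y (k + 1) := by rw [hT y, shift_apply]
  induction n generalizing y with
  | zero => simp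
  | succ n ih => rw [zpow_add_one, Equiv.Perm.mul_apply, ih, hone, ← add_assoc]
  | pred n ih =>
    rw [zpow_sub_one, Equiv.Perm.mul_apply, ih, ← sub_add_cancel (k + -n) 1, ← hone,
      Equiv.Perm.inv_def, T.apply_symm_apply, add_sub_assoc]

theorem exists_mpGroup_of_stationary [StandardBorelSpace X] [IsProbabilityMeasure μ]
    [NullSingletonClass μ] {ν : Measure (ℤ → X)} (hshift : MeasurePreserving (shift X) ν ν)
    (hmarginal : MeasurePreserving (fun x : ℤ → X => x 0) ν μ) {κ : Type*} [Finite κ]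
    {D : κ → Set X} (hD : ∀ i, MeasurableSet (D i)) :
    ∃ (T : mpGroup μ) (φ : X → ℤ → X), MeasurePreserving φ μ ν ∧ ∀ (n : ℤ) i,
      ((T ^ n : mpGroup μ) : Equiv.Perm X) ⁻¹' D i =ᵐ[μ] φ ⁻¹' ((fun x => x n) ⁻¹' D i) := by
  obtain ⟨φ, hφ, hφD⟩ := exists_equiv_of_extension hmarginal hD
  let T := mpGroup.ofMeasurableEquiv (φ.trans ((shift X).trans φ.symm))
    ((hφ.symm φ).comp (hshift.comp hφ))
  have hT : Function.Semiconj φ (T : Equiv.Perm X) (shift X) := fun x =>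
    φ.apply_symm_apply (shift X (φ x))
  refine ⟨T, φ, hφ, fun n i => ?_⟩
  have horbit : ((T ^ n : mpGroup μ) : Equiv.Perm X) ⁻¹' (((fun x => x 0) ∘ φ) ⁻¹' D i) =
      φ ⁻¹' ((fun x => x n) ⁻¹' D i) := by
    ext x
    simp only [mem_preimage, Function.comp_apply, Subgroup.coe_zpow,
      apply_zpow_of_semiconj_shift hT, zero_add]
  rw [← horbit]
  exact ((T ^ n).2.1.quasiMeasurePreserving.preimage_ae_eq (hφD i)).symm

theorem indep_image_of_iIndepFun {ν : Measure (ℤ → X)} {φ : X → ℤ → X}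
    (hφ : MeasurePreserving φ μ ν) {F : Finset ℤ}
    (hind : iIndepFun (fun (p : F) (x : ℤ → X) => x (-p)) ν) {n : ℕ}
    {ξ : MeasPartition X (Fin n)} {T : mpGroup μ} (hT : ∀ (p : ℤ) i,
      ((T ^ p : mpGroup μ) : Equiv.Perm X) ⁻¹' ξ.cell i =ᵐ[μ] φ ⁻¹' ((fun x => x p) ⁻¹' ξ.cell i)) :
    MeasPartition.Indep μ fun p : F => ξ.image (T ^ (p : ℤ)) := by
  have hcell (p : ℤ) (i) : (ξ.image (T ^ p)).cell i =ᵐ[μ]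
      φ ⁻¹' ((fun x => x (-p)) ⁻¹' ξ.cell i) := by
    have himage : (ξ.image (T ^ p)).cell i =
        ((T ^ (-p) : mpGroup μ) : Equiv.Perm X) ⁻¹' ξ.cell i := by
      rw [zpow_neg, Subgroup.coe_inv, Equiv.Perm.inv_def, ← Equiv.image_eq_preimage_symm]
      rfl
    exact himage ▸ hT (-p) i
  have hmeas (p : ℤ) (i) : MeasurableSet ((fun x : ℤ → X => x (-p)) ⁻¹' ξ.cell i) :=
    measurable_pi_apply _ (ξ.measurableSet_cell i)
  intro a
  calc μ.real ((MeasPartition.join fun p : F => ξ.image (T ^ (p : ℤ))).cell a)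
      = μ.real (φ ⁻¹' ⋂ p : F, (fun x => x (-p)) ⁻¹' ξ.cell (a p)) := by
        rw [preimage_iInter]
        exact measureReal_congr (Filter.EventuallyEq.countable_iInter fun p : F => hcell p (a p))
    _ = ν.real (⋂ p : F, (fun x => x (-p)) ⁻¹' ξ.cell (a p)) :=
        hφ.measureReal_preimage (MeasurableSet.iInter fun p : F => hmeas p (a p)).nullMeasurableSet
    _ = ∏ p : F, ν.real ((fun x => x (-p)) ⁻¹' ξ.cell (a p)) := by
        simp only [Measure.real, hind.meas_iInter fun p => ⟨_, ξ.measurableSet_cell (a p), rfl⟩,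
          ENNReal.toReal_prod]
    _ = ∏ p : F, μ.real ((ξ.image (T ^ (p : ℤ))).cell (a p)) :=
        Finset.prod_congr rfl fun p _ => by
          rw [measureReal_congr (hcell p (a p)),
            hφ.measureReal_preimage (hmeas p (a p)).nullMeasurableSet]

variable [StandardBorelSpace X] [IsProbabilityMeasure μ] [NullSingletonClass μ]

theorem exists_imageDist_inv_le_and_indep (S : mpGroup μ) (M : ℕ) [NeZero M] {κ : Type*} [Finite κ]
    {D : κ → Set X} (hD : ∀ i, MeasurableSet (D i)) {n : ℕ} (ξ : MeasPartition X (Fin n)) :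
    ∃ T : mpGroup μ, (∀ i, imageDist μ (D i) (T : Aut μ)⁻¹ (S : Aut μ)⁻¹ ≤ 1 / M) ∧
      ∀ F : Finset ℤ, (∀ p ∈ F, (M : ℤ) ∣ p) →
        MeasPartition.Indep μ fun p : F => ξ.image (T ^ (p : ℤ)) := by
  have hSD (i) : MeasurableSet ((S : Equiv.Perm X) ⁻¹' D i) := S.2.1.measurable (hD i)
  obtain ⟨T, φ, hφ, hT⟩ := exists_mpGroup_of_stationary (measurePreserving_shift_blockLaw S M)
    (measurePreserving_eval_blockLaw S M 0)
    (D := Sum.elim (Sum.elim D fun i => (S : Equiv.Perm X) ⁻¹' D i) ξ.cell)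
    (by rintro ((i | i) | i); exacts [hD i, hSD i, ξ.measurableSet_cell i])
  refine ⟨T, fun i => ?_, fun F hF => indep_image_of_iIndepFun hφ ?_ fun p i => hT p (.inr i)⟩
  · have hTD : (T : Equiv.Perm X) ⁻¹' D i =ᵐ[μ] φ ⁻¹' ((fun x => x 1) ⁻¹' D i) := by
      simpa only [zpow_one, Sum.elim_inl] using hT 1 (.inl (.inl i))
    have hSD' : (S : Equiv.Perm X) ⁻¹' D i =ᵐ[μ]
        φ ⁻¹' ((fun x => x 0) ⁻¹' ((S : Equiv.Perm X) ⁻¹' D i)) := by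
      simpa using hT 0 (.inl (.inr i))
    calc imageDist μ (D i) (T : Aut μ)⁻¹ (S : Aut μ)⁻¹
        = μ.real ((φ ⁻¹' ((fun x => x 1) ⁻¹' D i)) ∆
            (φ ⁻¹' ((fun x => x 0) ⁻¹' ((S : Equiv.Perm X) ⁻¹' D i)))) := by
          rw [imageDist_inv_mk]
          exact measureReal_congr (ae_eq_set_symmDiff hTD hSD')
      _ = (blockLaw S M).real
            (((fun x => x 1) ⁻¹' D i) ∆ ((fun x => x 0) ⁻¹' ((S : Equiv.Perm X) ⁻¹' D i))) :=
          measureReal_symmDiff_preimage hφ (measurable_pi_apply 1 (hD i))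
            (measurable_pi_apply 0 (hSD i))
      _ ≤ 1 / M := measureReal_blockLaw_symmDiff_le S M (hD i)
  · have hdiv (p : F) : -(p : ℤ) / M * M = -p := Int.ediv_mul_cancel ((hF p p.2).neg_right)
    have hinj : Function.Injective fun p : F => -(p : ℤ) / M := fun p q hpq => by
      simpa only [hdiv, neg_inj, SetLike.coe_eq_coe] using congrArg (· * (M : ℤ)) hpq
    simpa only [hdiv] using (iIndepFun_sample_blockLaw S M).precomp hinj

end Approximation

/-! ### Genericity -/

section Genericity

open ProbabilityTheory

variable {X : Type*} [MeasurableSpace X] {μ : Measure X}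

theorem le_pEntropy_of_frequently {P : ℕ → Finset ℤ} {n : ℕ} {ξ : MeasPartition X (Fin n)}
    {c : ℝ} {S : Aut μ} (h : ∃ᶠ j in atTop, c ≤ meanEntropy μ (P j) ξ S) :
    (c : EReal) ≤ pEntropy μ P S :=
  (le_limsup_of_frequently_le (h.mono fun _ hj => EReal.coe_le_coe_iff.2 hj)).trans <|
    le_iSup₂ (f := fun (n : ℕ) (ξ : MeasPartition X (Fin n)) =>
      limsup (fun j => (meanEntropy μ (P j) ξ S : EReal)) atTop) n ξ

theorem frequently_nonempty_progression {L : ℕ → ℕ} (hL : ∃ᶠ j in atTop, L j ≠ 0) :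
    ∃ᶠ j in atTop, (progression L j).Nonempty ∧ ∀ p ∈ progression L j, (j : ℤ) ∣ p := by
  refine hL.mono fun j hj => ⟨?_, ?_⟩
  · exact (Finset.nonempty_Icc.2 (Nat.one_le_iff_ne_zero.2 hj)).image _
  · exact Finset.forall_mem_image.2 fun k _ => dvd_mul_left _ _

variable [StandardBorelSpace X] [IsProbabilityMeasure μ] [NullSingletonClass μ]

variable (μ) in
theorem exists_measPartition_measureReal_eq (n : ℕ) [NeZero n] :
    ∃ ξ : MeasPartition X (Fin n), ∀ i, μ.real (ξ.cell i) = 1 / n := by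
  obtain ⟨e, he, -⟩ := exists_measurePreserving_equiv_of_label μ
    (μ.prod (uniformOn (univ : Set (Fin n)))) (f := fun _ => ()) (g := fun _ => ())
    measurable_const measurable_const (by simp only [Measure.map_const, measure_univ])
  have hlabel : MeasurePreserving (Prod.snd ∘ e) μ (uniformOn (univ : Set (Fin n))) :=
    measurePreserving_snd.comp he
  refine ⟨⟨fun i => Prod.snd ∘ e ⁻¹' {i}, fun i => hlabel.measurable (measurableSet_singleton i),
    fun i j hij => (disjoint_singleton.2 hij).preimage _, ?_⟩, fun i => ?_⟩
  · rw [← preimage_iUnion, iUnion_of_singleton, preimage_univ]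
  · rw [hlabel.measureReal_preimage (measurableSet_singleton i).nullMeasurableSet,
      uniformOn_univ_real_singleton, Fintype.card_fin]

variable (μ) in
theorem exists_lt_entropy (c : ℝ) : ∃ (n : ℕ) (ξ : MeasPartition X (Fin n)), c < ξ.entropy μ := by
  obtain ⟨n, hlog, hn⟩ := (((Real.tendsto_log_atTop.comp
    tendsto_natCast_atTop_atTop).eventually_gt_atTop c).and (eventually_ne_atTop 0)).exists
  have : NeZero n := ⟨hn⟩
  obtain ⟨ξ, hξ⟩ := exists_measPartition_measureReal_eq μ n
  refine ⟨n, ξ, hlog.trans_eq ?_⟩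
  simp [MeasPartition.entropy, hξ, hn]

theorem exists_weakTendsto_indep {A : ℕ → Set X} (hA : IsDenseSeq μ A) (S : mpGroup μ) {n : ℕ}
    (ξ : MeasPartition X (Fin n)) :
    ∃ T : ℕ → mpGroup μ, WeakTendsto (fun M => (T M : Aut μ)) atTop (S : Aut μ) ∧
      ∀ M : ℕ, M ≠ 0 → ∀ F : Finset ℤ, (∀ p ∈ F, (M : ℤ) ∣ p) →
        MeasPartition.Indep μ fun p : F => ξ.image (T M ^ (p : ℤ)) := by
  have happrox (M : ℕ) : ∃ T : mpGroup μ, M ≠ 0 →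
      (∀ i < M, imageDist μ (A i) (T : Aut μ)⁻¹ (S : Aut μ)⁻¹ ≤ 1 / M) ∧
        ∀ F : Finset ℤ, (∀ p ∈ F, (M : ℤ) ∣ p) →
          MeasPartition.Indep μ fun p : F => ξ.image (T ^ (p : ℤ)) := by
    obtain rfl | hM := eq_or_ne M 0
    · exact ⟨1, fun h => absurd rfl h⟩
    have : NeZero M := ⟨hM⟩
    obtain ⟨T, hTS, hT⟩ := exists_imageDist_inv_le_and_indep S M
      (fun i : Fin M => hA.measurableSet i) ξ
    exact ⟨T, fun _ => ⟨fun i hi => hTS ⟨i, hi⟩, hT⟩⟩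
  choose T hT using happrox
  have hinv : WeakTendsto (fun M => (T M : Aut μ)⁻¹) atTop (S : Aut μ)⁻¹ :=
    .of_isDenseSeq hA fun i => squeeze_zero' (.of_forall fun _ => imageDist_nonneg _ _ _ _)
      (by filter_upwards [eventually_gt_atTop i] with M hM using (hT M (by lia)).1 i hM)
      tendsto_one_div_atTop_nhds_zero_nat
  exact ⟨T, by simpa only [inv_inv] using hinv.inv, fun M hM => (hT M hM).2⟩

theorem dense_exists_lt_meanEntropy {A : ℕ → Set X} (hA : IsDenseSeq μ A) {P : ℕ → Finset ℤ}
    (hP : ∃ᶠ j in atTop, (P j).Nonempty ∧ ∀ p ∈ P j, (j : ℤ) ∣ p) {n : ℕ}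
    {ξ : MeasPartition X (Fin n)} {c : ℝ} (hc : c < ξ.entropy μ) (N : ℕ) :
    letI : MetricSpace (Aut μ) := halmosMetric μ A hA
    Dense (⋃ j ≥ N, {S : Aut μ | c < meanEntropy μ (P j) ξ S}) := by
  let _ : MetricSpace (Aut μ) := halmosMetric μ A hA
  intro S
  obtain ⟨S, rfl⟩ := QuotientGroup.mk_surjective S
  obtain ⟨T, hTS, hT⟩ := exists_weakTendsto_indep hA S ξ
  refine mem_closure_of_frequently_of_tendsto ?_ ((tendsto_nhds_halmosMetric_iff hA).2 hTS)
  refine (hP.and_eventually (eventually_gt_atTop N)).mono fun j ⟨⟨hne, hdvd⟩, hj⟩ => ?_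
  have hent := meanEntropy_of_indep hne (hT j (by lia) (P j) hdvd)
  exact mem_iUnion₂.2 ⟨j, hj.le, hc.trans_eq hent.symm⟩

end Genericity

end KushnirenkoEntropy

end

open KushnirenkoEntropy in
theorem mainTheorem2_general {X : Type*} [MeasurableSpace X] [StandardBorelSpace X]
    {μ : Measure X} [IsProbabilityMeasure μ] [NullSingletonClass μ]
    {A : ℕ → Set X} (hA : IsDenseSeq μ A) {P : ℕ → Finset ℤ}
    (hP : ∃ᶠ j in atTop, (P j).Nonempty ∧ ∀ p ∈ P j, (j : ℤ) ∣ p) :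
    letI : MetricSpace (Aut μ) := halmosMetric μ A hA
    IsGeneric {S : Aut μ | pEntropy μ P S = ⊤} := by
  let _ : MetricSpace (Aut μ) := halmosMetric μ A hA
  have := completeSpace_halmosMetric hA
  choose n ξ hξ using exists_lt_entropy μ
  let U : ℕ × ℕ → Set (Aut μ) := fun q =>
    ⋃ j ≥ q.2, {S : Aut μ | (q.1 : ℝ) < meanEntropy μ (P j) (ξ q.1) S}
  have hU (q) : IsOpen (U q) := isOpen_biUnion fun j _ =>
    isOpen_lt continuous_const (continuous_meanEntropy hA (P j) (ξ q.1))
  refine ⟨⋂ q, U q, fun S hS => EReal.eq_top_iff_forall_lt _ |>.2 fun y => ?_,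
    .iInter_of_isOpen hU,
    dense_iInter_of_isOpen hU fun q => dense_exists_lt_meanEntropy hA hP (hξ q.1) q.2⟩
  obtain ⟨c, hc⟩ := exists_nat_gt y
  refine (EReal.coe_lt_coe_iff.2 hc).trans_le
    (le_pEntropy_of_frequently (ξ := ξ c) (frequently_atTop.2 fun N => ?_))
  obtain ⟨j, hj, hjS⟩ := mem_iUnion₂.1 (mem_iInter.1 hS (c, N))
  exact ⟨j, hj, hjS.le⟩

theorem mainTheorem2 {X : Type*} [MeasurableSpace X] [StandardBorelSpace X]
    (μ : Measure X) [IsProbabilityMeasure μ] [NullSingletonClass μ]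
    (A : ℕ → Set X) (hA : KushnirenkoEntropy.IsDenseSeq μ A)
    (L : ℕ → ℕ) (hL : Tendsto L atTop atTop) :
    letI : MetricSpace (KushnirenkoEntropy.Aut μ) := KushnirenkoEntropy.halmosMetric μ A hA
    KushnirenkoEntropy.IsGeneric
      {S : KushnirenkoEntropy.Aut μ |
        KushnirenkoEntropy.pEntropy μ (KushnirenkoEntropy.progression L) S = ⊤} :=
  mainTheorem2_general hA
    (KushnirenkoEntropy.frequently_nonempty_progression (hL.eventually_ne_atTop 0).frequently)
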